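/- Let $\alpha\in\mathbb{C}\setminus\{-1,-2,\dots\}$ and let $\mathcal F=(F_1,F_2)$ be a pair of (possibly empty) finite sets of positive integers, with $k_i=|F_i|$, $k=k_1+k_2$ and $u_{\mathcal F}=\sum_{f\in F_1}f+\sum_{f\in F_2}f-\binom{k_1+1}{2}-\binom{k_2}{2}$. Let $L_n^{\alpha}(x)=\sum_{j=0}^n\frac{(-x)^j}{j!}\binom{n+\alpha}{n-j}$ be the Laguerre polynomials. Let $\Omega_{\mathcal F}^{\alpha}(x)$ be the $k\times k$ determinant whose rows are $\big(L_f^{\alpha}(x),(L_f^{\alpha})'(x),\dots,(L_f^{\alpha})^{(k-1)}(x)\big)$ for $f\in F_1$ (in increasing order), followed by $\big(L_f^{\alpha}(-x),L_f^{\alpha+1}(-x),\dots,L_f^{\alpha+k-1}(-x)\big)$ for $f\in F_2$ (in increasing order); it equals $1$ if $k=0$. For an integer $n\ge 0$ with $n\notin F_1$, let the exceptional Laguerre polynomial $L_{n+u_{\mathcal F}}^{\alpha;\mathcal F}(x)$ be the $(k+1)\times(k+1)$ determinant with first row $\big(L_n^{\alpha}(x),(L_n^{\alpha})'(x),\dots,(L_n^{\alpha})^{(k)}(x)\big)$,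 followed by the rows $\big(L_f^{\alpha}(x),\dots,(L_f^{\alpha})^{(k)}(x)\big)$, $f\in F_1$, and $\big(L_f^{\alpha}(-x),L_f^{\alpha+1}(-x),\dots,L_f^{\alpha+k}(-x)\big)$, $f\in F_2$. For $r>0$ let $\Lambda_r$ be the path formed by the half lines $x\pm ri$, $x\in[0,+\infty)$, and the left half of the circle with center $0$ and radius $r$, positively oriented: it comes in from $+\infty+ri$ to $ri$, runs counterclockwise along the half circle through $-r$ to $-ri$, and goes out from $-ri$ to $+\infty-ri$. For $a\in\mathbb C$ and $z\in\mathbb{C}\setminus[0,+\infty)$ put $z^a=e^{a\log z}$, where $\log$ is the branch of the logarithm on $\mathbb{C}\setminus[0,+\infty)$ with $\log i=i\pi/2$. Then there exists $r>0$ such that $\Omega_{\mathcal F}^{\alpha}$ has no zero on $\Lambda_r$ and, for all integers $n,m\ge 0$ with $n,m\notin F_1$, the following integral converges absolutely and $$\int_{\Lambda_r} L_{n+u_{\mathcal F}}^{\alpha;\mathcal F}(z)\,L_{m+u_{\mathcal F}}^{\alpha;\mathcal F}(z)\,\frac{z^{\alpha+k}e^{-z}}{\Omega_{\mathcal F}^{\alpha}(z)^2}\,dz=(e^{2\pi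 i\alpha}-1)\,\frac{\Gamma(n+\alpha+1)\prod_{f\in F_1}(n-f)\prod_{f\in F_2}(n+\alpha+f+1)}{n!}\,\delta_{n,m}.$$ -/

import Mathlib

open Polynomial

noncomputable section

namespace ExceptionalLaguerre

/-- The Laguerre polynomial `L_n^α(x) = ∑_{j=0}^n ((-x)^j / j!) * binom (n + α) (n - j)`. -/
def laguerre (α : ℂ) (n : ℕ) : ℂ[X] :=
  ∑ j ∈ Finset.range (n + 1),
    C ((-1) ^ j / (j.factorial : ℂ) * Ring.choose ((n : ℂ) + α) (n - j)) * X ^ j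

/-- The integer `u_F = ∑_{f ∈ F₁} f + ∑_{f ∈ F₂} f - binom (k₁ + 1) 2 - binom k₂ 2`.
For finite sets of positive integers the subtraction does not truncate
(see `shift_add_choose`). -/
def shift (F₁ F₂ : Finset ℕ) : ℕ :=
  (∑ f ∈ F₁, f + ∑ f ∈ F₂, f) - ((F₁.card + 1).choose 2 + F₂.card.choose 2)

theorem choose_two_le_sum (F : Finset ℕ) (hF : ∀ f ∈ F, 0 < f) :
    (F.card + 1).choose 2 ≤ ∑ f ∈ F, f := by
  induction F using Finset.induction_on_max with
  | empty => simp
  | insert a s hs ih =>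
    have ha : a ∉ s := fun h => lt_irrefl _ (hs a h)
    rw [Finset.sum_insert ha, Finset.card_insert_of_notMem ha, Nat.choose_succ_succ']
    have h1 := ih (fun f hf => hF f (Finset.mem_insert_of_mem hf))
    have h2 : insert a s ⊆ Finset.Icc 1 a := by
      intro x hx
      have h0 := hF x hx
      rcases Finset.mem_insert.mp hx with rfl | h
      · exact Finset.mem_Icc.mpr ⟨h0, le_refl _⟩
      · exact Finset.mem_Icc.mpr ⟨h0, (hs x h).le⟩
    have h3 := Finset.card_le_card h2
    rw [Finset.card_insert_of_notMem ha, Nat.card_Icc] at h3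
    simp only [Nat.choose_one_right, Nat.reduceAdd]
    omega

theorem shift_add_choose (F₁ F₂ : Finset ℕ) (h₁ : ∀ f ∈ F₁, 0 < f) (h₂ : ∀ f ∈ F₂, 0 < f) :
    shift F₁ F₂ + ((F₁.card + 1).choose 2 + F₂.card.choose 2)
      = ∑ f ∈ F₁, f + ∑ f ∈ F₂, f := by
  have a := choose_two_le_sum F₁ h₁
  have b := choose_two_le_sum F₂ h₂
  have c : F₂.card.choose 2 ≤ (F₂.card + 1).choose 2 := Nat.choose_le_choose 2 (Nat.le_succ _)
  unfold shift
  omega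

/-- The rows contributed by `F₁` and `F₂`, in increasing order of each set, as functions of the
column index `j = 0, 1, …`: a row `(L_f^α)^{(j)}(x)` for `f ∈ F₁`, followed by a row
`L_f^{α+j}(-x)` for `f ∈ F₂`. -/
def rows (α : ℂ) (F₁ F₂ : Finset ℕ) : Fin (F₁.card + F₂.card) → ℕ → ℂ[X] :=
  Fin.append
    (fun i j => derivative^[j] (laguerre α (F₁.orderEmbOfFin rfl i)))
    (fun i j => (laguerre (α + j) (F₂.orderEmbOfFin rfl i)).comp (-X))

/-- The `k × k` determinant `Ω_F^α`, where `k = k₁ + k₂`. -/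
def Omega (α : ℂ) (F₁ F₂ : Finset ℕ) : ℂ[X] :=
  Matrix.det (Matrix.of fun i j : Fin (F₁.card + F₂.card) => rows α F₁ F₂ i j)

/-- The exceptional Laguerre polynomial `L_n^{α;F}`, a `(k + 1) × (k + 1)` determinant whose
first row is `(L_{n-u_F}^α)^{(j)}(x)`. It is meant for `n = u_F + m` with `m ∉ F₁`. -/
def exceptionalLaguerre (α : ℂ) (F₁ F₂ : Finset ℕ) (n : ℕ) : ℂ[X] :=
  Matrix.det (Matrix.of fun i j : Fin (F₁.card + F₂.card + 1) =>
    (Fin.cons (fun l => derivative^[l] (laguerre α (n - shift F₁ F₂))) (rows α F₁ F₂) :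
      Fin (F₁.card + F₂.card + 1) → ℕ → ℂ[X]) i j)

/-- The branch of the logarithm on `ℂ ∖ [0, ∞)` with `log i = i π / 2`. -/
def branchLog (z : ℂ) : ℂ := Complex.log (-z) + Real.pi * Complex.I

/-- The power `z ^ a = exp (a log z)` for that branch. -/
def branchPow (z a : ℂ) : ℂ := Complex.exp (a * branchLog z)

/-- The points of the path `Λ_r`: the half lines `x ± r i`, `x ≥ 0`, and the left half of the
circle of radius `r` around `0`. -/
def pathSet (r : ℝ) : Set ℂ :=
  {z | (0 ≤ z.re ∧ |z.im| = r) ∨ (z.re ≤ 0 ∧ ‖z‖ = r)}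

/-- The point `r e^{iθ}`. -/
def arcPoint (r θ : ℝ) : ℂ := r * Complex.exp (θ * Complex.I)

/-- Absolute integrability of `f` along the three pieces of `Λ_r`. -/
def PathIntegrable (r : ℝ) (f : ℂ → ℂ) : Prop :=
  MeasureTheory.IntegrableOn (fun x : ℝ => f (x + r * Complex.I)) (Set.Ioi 0) ∧
  IntervalIntegrable (fun θ : ℝ => f (arcPoint r θ) * (Complex.I * arcPoint r θ))
    MeasureTheory.volume (Real.pi / 2) (3 * Real.pi / 2) ∧
  MeasureTheory.IntegrableOn (fun x : ℝ => f (x - r * Complex.I)) (Set.Ioi 0)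

/-- The integral of `f` along `Λ_r`, positively (counterclockwise) oriented: in from `+∞ + r i`
to `r i`, along the left half circle from `r i` to `-r i`, and out from `-r i` to `+∞ - r i`. -/
def pathIntegral (r : ℝ) (f : ℂ → ℂ) : ℂ :=
  -(∫ x in Set.Ioi (0 : ℝ), f (x + r * Complex.I))
  + (∫ θ in (Real.pi / 2)..(3 * Real.pi / 2), f (arcPoint r θ) * (Complex.I * arcPoint r θ))
  + ∫ x in Set.Ioi (0 : ℝ), f (x - r * Complex.I)

/-- The integrand
`L_{n+u_F}^{α;F}(z) L_{m+u_F}^{α;F}(z) z^{α+k} e^{-z} / Ω_F^α(z)^2`. -/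
def integrand (α : ℂ) (F₁ F₂ : Finset ℕ) (n m : ℕ) (z : ℂ) : ℂ :=
  (exceptionalLaguerre α F₁ F₂ (n + shift F₁ F₂)).eval z
    * (exceptionalLaguerre α F₁ F₂ (m + shift F₁ F₂)).eval z
    * (branchPow z (α + (F₁.card + F₂.card : ℕ)) * Complex.exp (-z)
      / (Omega α F₁ F₂).eval z ^ 2)

end ExceptionalLaguerre

end

noncomputable section

namespace ExceptionalLaguerre

/-! ### Derivations on fraction fields -/

section Derivation

/-! The functions `L_f^α(x)`, `f ∈ F₁`, and `e^x L_f^α(-x)`, `f ∈ F₂`, are eigenfunctions of the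
Laguerre operator `x∂² + (α + 1 - x)∂` with eigenvalues `-f` and `α + 1 + f`. These are pairwise
distinct because `α` is not a negative integer. Since `L^{α+1} = L^α - (L^α)'`, the rows of `Ω` list
the derivatives of these seed functions up to an exponential factor, so `Ω` is essentially their
Wronskian and the exceptional polynomial is, up to sign, the Wronskian with `L_n^α` adjoined.

The seeds can be used one at a time. If `u` is a seed with eigenvalue `μ` and `A y = y' - (u'/u) y`,
the operator factors as `B A + μ` with `B` of first order, and `A B + μ` is the operator of the next
stage. Crum's formula writes the iterated transform of `y` as `W_k[y] / W_k`, where `W_k` is the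
Wronskian of the first `k` seeds (`wr_chain`). For the weights `z^{α+k} e^{-z}`, integration by
parts makes `-B` the transpose of `A`, and `B A` acts on the transform of `L_n^α` as `-n - λ_k`;
hence passing from `k` to `k + 1` multiplies the pairing by `n + λ_k` (`pathIntegral_darboux_step`).
These factors give the two products over `F₁` and `F₂`.

What remains is `k = 0`, orthogonality of Laguerre polynomials on `Λ_r` (`pathIntegral_laguerre`).
The same step with the constant seed reduces it to a Hankel-type integral for `Γ`
(`pathIntegral_branchPow`). The radius only has to keep `Λ_r` away from the finitely many zeros of
all `W_k`. -/

/-- The quotient rule on a chosen fraction for each element; `key` shows independence of the choice.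
Logarithmic derivatives of polynomials can then be handled algebraically. -/
theorem exists_derivation_extending {A K : Type*} [CommRing A] [IsDomain A] [Field K]
    [Algebra A K] [IsFractionRing A K] (d : Derivation ℤ A A) :
    ∃ D : Derivation ℤ K K, ∀ a, D (algebraMap A K a) = algebraMap A K (d a) := by
  have inj : ∀ a : A, a ≠ 0 → algebraMap A K a ≠ 0 := fun a ha h =>
    ha ((IsFractionRing.injective A K) (by rw [h, map_zero]))
  have hs : ∀ f : K, ∃ p : A × A, p.2 ≠ 0 ∧ f = algebraMap A K p.1 / algebraMap A K p.2 := by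
    intro f
    obtain ⟨a, b, hb, rfl⟩ := IsFractionRing.div_surjective (A := A) f
    exact ⟨(a, b), nonZeroDivisors.ne_zero hb, rfl⟩
  choose p hp0 hp using hs
  let D : K → K := fun f => algebraMap A K (d (p f).1 * (p f).2 - (p f).1 * d (p f).2)
    / algebraMap A K (p f).2 ^ 2
  have key : ∀ (f : K) (a b : A), b ≠ 0 → f = algebraMap A K a / algebraMap A K b →
      D f = algebraMap A K (d a * b - a * d b) / algebraMap A K b ^ 2 := by
    intro f a b hb hf
    have h0 := inj _ hb
    have h1 := inj _ (hp0 f)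
    have h2 : a * (p f).2 = (p f).1 * b := by
      apply IsFractionRing.injective A K
      have := (hp f).symm.trans hf
      rw [div_eq_div_iff h1 h0] at this
      simpa using this.symm
    have h3 := congrArg d h2
    simp only [Derivation.leibniz, smul_eq_mul] at h3
    have h2' := congrArg (algebraMap A K) h2
    have h3' := congrArg (algebraMap A K) h3
    simp only [map_add, map_mul] at h2' h3'
    change algebraMap A K _ / _ = _
    rw [div_eq_div_iff (pow_ne_zero _ h1) (pow_ne_zero _ h0)]
    simp only [map_sub, map_mul]
    linear_combination (-algebraMap A K b * algebraMap A K (p f).2) * h3'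
      + (algebraMap A K (d b) * algebraMap A K (p f).2
        + algebraMap A K b * algebraMap A K (d (p f).2)) * h2'
  have hadd : ∀ f g, D (f + g) = D f + D g := by
    intro f g
    have h0 := inj _ (hp0 f)
    have h1 := inj _ (hp0 g)
    rw [key (f + g) ((p f).1 * (p g).2 + (p g).1 * (p f).2) ((p f).2 * (p g).2)
      (mul_ne_zero (hp0 f) (hp0 g)) (by
        conv_lhs => rw [hp f, hp g]
        simp only [map_add, map_mul]
        field_simp)]
    simp only [D, Derivation.leibniz, smul_eq_mul, map_add, map_sub, map_mul]
    field_simp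
    ring
  have hmul : ∀ f g, D (f * g) = f • D g + g • D f := by
    intro f g
    have h0 := inj _ (hp0 f)
    have h1 := inj _ (hp0 g)
    rw [key (f * g) ((p f).1 * (p g).1) ((p f).2 * (p g).2)
      (mul_ne_zero (hp0 f) (hp0 g)) (by
        conv_lhs => rw [hp f, hp g]
        simp only [map_mul]
        field_simp)]
    have e1 : f * algebraMap A K (p f).2 = algebraMap A K (p f).1 :=
      (eq_div_iff h0).1 (hp f)
    have e2 : g * algebraMap A K (p g).2 = algebraMap A K (p g).1 :=
      (eq_div_iff h1).1 (hp g)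
    simp only [D, Derivation.leibniz, smul_eq_mul, map_add, map_sub, map_mul]
    field_simp
    rw [← e1, ← e2]
    ring
  refine ⟨Derivation.mk' (AddMonoidHom.toIntLinearMap (AddMonoidHom.mk' D hadd)) hmul, ?_⟩
  intro a
  change D (algebraMap A K a) = _
  rw [key _ a 1 one_ne_zero (by simp)]
  simp

end Derivation

/-! ### Iterated Darboux transforms over a differential field -/

section Darboux

variable {K : Type*} [Field K] (D : Derivation ℤ K K)

/-- The derivative conjugated by an exponential `e` with `e' = c e`. -/
def twist (c y : K) : K := D y + c * y

/-- The iterated Darboux transform of `y` (twisted by `c`) with seeds `φ 0, φ 1, …`, each seed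
being given by its twist and its value. -/
def darboux (φ : ℕ → K × K) : ℕ → K → K → K
  | 0, _, y => y
  | k + 1, c, y => twist D c (darboux φ k c y)
      - twist D (φ k).1 (darboux φ k (φ k).1 (φ k).2) / darboux φ k (φ k).1 (φ k).2
        * darboux φ k c y

variable {D}

theorem twist_sub (c y z : K) : twist D c (y - z) = twist D c y - twist D c z := by
  simp only [twist, map_sub]; ring

theorem twist_mul (c a y : K) : twist D c (a * y) = D a * y + a * twist D c y := by
  simp only [twist, Derivation.leibniz, smul_eq_mul]; ring

theorem twist_zero (c : K) : twist D c 0 = 0 := by simp [twist]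

/-- The factorization `L - mu = B A`: the eigenvalue equation of `u` becomes a Riccati equation for
its logarithmic derivative `h` (`h2`), which is what makes the zeroth-order terms match. -/
theorem darboux_intertwine {x a q lam mu c c₀ y u : K} (hu : u ≠ 0)
    (eu : x * twist D c₀ (twist D c₀ u) + (a - x) * twist D c₀ u + q * u = mu * u)
    (ey : x * twist D c (twist D c y) + (a - x) * twist D c y + q * y = lam * y) :
    x * twist D c (twist D c y - twist D c₀ u / u * y)
      + (x * (twist D c₀ u / u) + a - x) * (twist D c y - twist D c₀ u / u * y)
      = (lam - mu) * y := by
  obtain ⟨h, hh⟩ : ∃ h, h = twist D c₀ u / u := ⟨_, rfl⟩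
  have h1 : twist D c₀ u = h * u := by rw [hh]; field_simp
  rw [← hh]
  rw [h1, twist_mul, h1] at eu
  have h2 : x * (D h + h ^ 2) + (a - x) * h + q = mu := by
    apply mul_right_cancel₀ hu
    linear_combination eu
  rw [twist_sub, twist_mul]
  linear_combination ey - y * h2

/-- Applying `A = ∂ - h` to `B y₁ = (lam - mu) y` gives `A B y₁ = (lam - mu) y₁`. Since `D x = 1`,
the parameter `a` rises by one. -/
theorem darboux_eigen {x a h lam mu c y y₁ : K} (hx : D x = 1) (ha : D a = 0)
    (hlam : D lam = 0) (hmu : D mu = 0) (hy : y₁ = twist D c y - h * y)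
    (hB : x * twist D c y₁ + (x * h + a - x) * y₁ = (lam - mu) * y) :
    x * twist D c (twist D c y₁) + (a + 1 - x) * twist D c y₁
      + (D (x * h - x) - h * (x * h + a - x) + mu) * y₁ = lam * y₁ := by
  have h1 := congrArg (twist D c) hB
  have e : ∀ y z, twist D c (y + z) = twist D c y + twist D c z := fun y z => by
    simp only [twist, map_add]; ring
  rw [e, twist_mul, twist_mul, twist_mul, hx] at h1
  have h2 : D (lam - mu) = 0 := by simp [hlam, hmu]
  have h3 : D (x * h + a - x) = D (x * h - x) := by simp [ha]
  rw [h2, h3] at h1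
  linear_combination h1 - h * hB - (lam - mu) * hy

/-- The potential `q` depends only on the seeds, so one induction treats all eigenfunctions at once.
Distinct eigenvalues keep each new seed nonzero: if `A y = 0`, then `0 = B A y = (l - lam k) y`.
This allows division by it at the next stage. -/
theorem darboux_chain {x a : K} (hx : D x = 1) (ha : D a = 0) (φ : ℕ → K × K) (lam : ℕ → K)
    (N : ℕ) (h0 : ∀ i < N, (φ i).2 ≠ 0) (hl : ∀ i < N, D (lam i) = 0)
    (hlam : ∀ i < N, ∀ j < i, lam i ≠ lam j)
    (hE : ∀ i < N, x * twist D (φ i).1 (twist D (φ i).1 (φ i).2)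
      + (a - x) * twist D (φ i).1 (φ i).2 = lam i * (φ i).2) (k : ℕ) (hk : k ≤ N) :
    (∃ q, ∀ c y l, D l = 0 → x * twist D c (twist D c y) + (a - x) * twist D c y = l * y →
      x * twist D c (twist D c (darboux D φ k c y)) + (a + k - x) * twist D c (darboux D φ k c y)
        + q * darboux D φ k c y = l * darboux D φ k c y) ∧
    (∀ c y l, D l = 0 → x * twist D c (twist D c y) + (a - x) * twist D c y = l * y → y ≠ 0 →
      (∀ i < k, l ≠ lam i) → darboux D φ k c y ≠ 0) ∧
    (∀ j < k, darboux D φ j (φ j).1 (φ j).2 ≠ 0 ∧ ∀ c y l, D l = 0 →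
      x * twist D c (twist D c y) + (a - x) * twist D c y = l * y →
      x * twist D c (darboux D φ (j + 1) c y) +
        (x * (twist D (φ j).1 (darboux D φ j (φ j).1 (φ j).2) / darboux D φ j (φ j).1 (φ j).2)
          + (a + j) - x) * darboux D φ (j + 1) c y = (l - lam j) * darboux D φ j c y) := by
  induction k with
  | zero =>
    refine ⟨⟨0, fun c y l _ h => ?_⟩, fun c y l _ _ h _ => h, fun j hj => by omega⟩
    simpa [darboux] using h
  | succ k ih =>
    obtain ⟨⟨q, hq⟩, hn, hB⟩ := ih (by omega)
    have hkN : k < N := by omega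
    have hu := hn (φ k).1 (φ k).2 (lam k) (hl k hkN) (hE k hkN) (h0 k hkN)
      (fun i hi => hlam k hkN i hi)
    have eu := hq (φ k).1 (φ k).2 (lam k) (hl k hkN) (hE k hkN)
    have hB' : ∀ c y l, D l = 0 →
        x * twist D c (twist D c y) + (a - x) * twist D c y = l * y →
        x * twist D c (darboux D φ (k + 1) c y) +
        (x * (twist D (φ k).1 (darboux D φ k (φ k).1 (φ k).2) / darboux D φ k (φ k).1 (φ k).2)
          + (a + k) - x) * darboux D φ (k + 1) c y = (l - lam k) * darboux D φ k c y :=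
      fun c y l hl' h => darboux_intertwine hu eu (hq c y l hl' h)
    obtain ⟨h', hh'⟩ : ∃ h', h' = twist D (φ k).1 (darboux D φ k (φ k).1 (φ k).2)
      / darboux D φ k (φ k).1 (φ k).2 := ⟨_, rfl⟩
    refine ⟨⟨D (x * h' - x) - h' * (x * h' + (a + k) - x) + lam k, fun c y l hl' h => ?_⟩,
      fun c y l hl' h hy hne hz => ?_, fun j hj => ?_⟩
    · rw [hh']
      have := darboux_eigen hx (by simp [ha] : D (a + k) = 0) hl' (hl k hkN) rfl (hB' c y l hl' h)
      push_cast
      rw [← add_assoc]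
      exact this
    · have := hB' c y l hl' h
      rw [hz, twist_zero, mul_zero, mul_zero, add_zero] at this
      exact mul_ne_zero (sub_ne_zero.2 (hne k (by omega)))
        (hn c y l hl' h hy fun i hi => hne i (by omega)) this.symm
    · rcases Nat.lt_succ_iff_lt_or_eq.1 hj with h | rfl
      · exact hB j h
      · exact ⟨hu, hB'⟩

/-- The transform is a monic differential operator of order `k` whose coefficients do not depend on
`c` or `y`; the same combination of columns then works for every row of a Wronskian. -/
theorem darboux_eq_sum (φ : ℕ → K × K) (k : ℕ) :
    ∃ b : ℕ → K, b k = 1 ∧ (∀ j, k < j → b j = 0) ∧ ∀ c y,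
      darboux D φ k c y = ∑ j ∈ Finset.range (k + 1), b j * (twist D c)^[j] y := by
  induction k with
  | zero => exact ⟨fun j => if j = 0 then 1 else 0, by simp, fun j hj => by simp; omega,
      fun c y => by simp [darboux]⟩
  | succ k ih =>
    obtain ⟨b, hb1, hb0, hb⟩ := ih
    obtain ⟨h, hh⟩ : ∃ h, h = twist D (φ k).1 (darboux D φ k (φ k).1 (φ k).2)
      / darboux D φ k (φ k).1 (φ k).2 := ⟨_, rfl⟩
    -- Coefficients of `(∂ - h) ∘ ∑ b_j ∂^j` by the Leibniz rule; the `if` guards the truncated `j -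
    -- 1` at `j = 0`.
    refine ⟨fun j => D (b j) - h * b j + if j = 0 then 0 else b (j - 1), ?_, ?_, ?_⟩
    · simp [hb0 (k + 1) (by omega), hb1]
    · intro j hj
      dsimp only
      rw [hb0 j (by omega), hb0 (j - 1) (by omega)]
      simp
    · intro c y
      have e : ∀ (s : Finset ℕ) (f : ℕ → K),
          twist D c (∑ i ∈ s, f i) = ∑ i ∈ s, twist D c (f i) := by
        intro s f
        simp only [twist, map_sum, Finset.mul_sum, Finset.sum_add_distrib]
      simp only [darboux, ← hh]
      rw [hb, e]
      simp only [twist_mul, add_mul, Finset.sum_add_distrib, sub_mul, Finset.sum_sub_distrib]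
      have e1 : ∑ j ∈ Finset.range (k + 1 + 1), D (b j) * (twist D c)^[j] y
          = ∑ j ∈ Finset.range (k + 1), D (b j) * (twist D c)^[j] y := by
        rw [Finset.sum_range_succ, hb0 (k + 1) (by omega)]; simp
      have e2 : ∑ j ∈ Finset.range (k + 1 + 1), h * b j * (twist D c)^[j] y
          = h * ∑ j ∈ Finset.range (k + 1), b j * (twist D c)^[j] y := by
        rw [Finset.sum_range_succ, hb0 (k + 1) (by omega), Finset.mul_sum]; simp [mul_assoc]
      have e3 : ∑ j ∈ Finset.range (k + 1 + 1),
          (if j = 0 then 0 else b (j - 1)) * (twist D c)^[j] y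
          = ∑ j ∈ Finset.range (k + 1), b j * twist D c ((twist D c)^[j] y) := by
        rw [Finset.sum_range_succ']
        simp only [Function.iterate_succ_apply', Nat.add_sub_cancel, Nat.add_eq_zero_iff,
          one_ne_zero, and_false, if_false, if_true, zero_mul, add_zero]
      rw [e1, e2, e3]
      ring

theorem darboux_seed (φ : ℕ → K × K) (k i : ℕ) (hi : i < k)
    (h0 : darboux D φ i (φ i).1 (φ i).2 ≠ 0) : darboux D φ k (φ i).1 (φ i).2 = 0 := by
  induction k with
  | zero => omega
  | succ k ih =>
    rcases Nat.lt_succ_iff_lt_or_eq.1 hi with h | rfl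
    · simp [darboux, ih h, twist_zero]
    · simp [darboux, h0]

end Darboux

/-! ### Wronskian determinants and Crum's formula -/

/-- Replacing the last column by the combination with coefficients `b` preserves the determinant
because `b k = 1`. The new column vanishes except at the bottom. With `b` from `darboux_eq_sum` this
is Crum's formula. -/
theorem det_snoc_eq_mul {R : Type*} [CommRing R] (k : ℕ) (r : Fin k → ℕ → R) (s b : ℕ → R)
    (hb : b k = 1) (hr : ∀ i, ∑ j ∈ Finset.range (k + 1), b j * r i j = 0) :
    Matrix.det (Matrix.of fun i j : Fin (k + 1) =>
      (Fin.snoc r s : Fin (k + 1) → ℕ → R) i j)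
      = (∑ j ∈ Finset.range (k + 1), b j * s j)
        * Matrix.det (Matrix.of fun i j : Fin k => r i j) := by
  set M := (Matrix.of fun i j : Fin (k + 1) => (Fin.snoc r s : Fin (k + 1) → ℕ → R) i j) with hM
  have h := Matrix.det_updateCol_sum M (Fin.last k) (fun j => b j)
  simp only [Fin.val_last, hb, one_smul] at h
  rw [← h, Matrix.det_succ_column _ (Fin.last k), Fin.sum_univ_castSucc]
  have hz : ∀ i : Fin k, ∑ j : Fin (k + 1), b j • M i.castSucc j = 0 := by
    intro i
    rw [← hr i, Finset.sum_range]
    simp [hM]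
  have hl : ∑ j : Fin (k + 1), b j • M (Fin.last k) j = ∑ j ∈ Finset.range (k + 1), b j * s j := by
    rw [Finset.sum_range]
    simp [hM]
  simp only [Matrix.updateCol_self, hz, hl, mul_zero, zero_mul, Finset.sum_const_zero, zero_add,
    Fin.val_last]
  rw [← two_mul, pow_mul]
  simp only [even_two, Even.neg_pow, one_pow, one_mul]
  congr 2
  ext i j
  simp [hM, Fin.succAbove_last, Fin.castSucc_ne_last]

theorem det_cons_eq_snoc {R : Type*} [CommRing R] (k : ℕ) (r : Fin k → ℕ → R) (s : ℕ → R) :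
    Matrix.det (Matrix.of fun i j : Fin (k + 1) =>
      (Fin.cons s r : Fin (k + 1) → ℕ → R) i j)
      = (-1) ^ k * Matrix.det (Matrix.of fun i j : Fin (k + 1) =>
      (Fin.snoc r s : Fin (k + 1) → ℕ → R) i j) := by
  rw [Matrix.det_succ_row_zero, Matrix.det_succ_row _ (Fin.last k), Finset.mul_sum]
  refine Finset.sum_congr rfl fun j _ => ?_
  have h : (-1 : R) ^ k * (-1) ^ (k + (j : ℕ)) = (-1) ^ (j : ℕ) := by
    rw [← pow_add, ← add_assoc, pow_add, ← two_mul, pow_mul]; simp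
  have e : ((Matrix.of fun i j : Fin (k + 1) =>
      (Fin.cons s r : Fin (k + 1) → ℕ → R) i j).submatrix Fin.succ j.succAbove)
      = ((Matrix.of fun i j : Fin (k + 1) =>
      (Fin.snoc r s : Fin (k + 1) → ℕ → R) i j).submatrix (Fin.last k).succAbove j.succAbove) := by
    ext a b
    simp [Fin.succAbove_last]
  rw [e, ← h]
  simp only [Matrix.of_apply, Fin.cons_zero, Fin.snoc_last, Fin.val_last]
  ring

/-- The derivative conjugated by `x ↦ exp (c x)`. -/
def polyTwist (c : ℂ) (p : ℂ[X]) : ℂ[X] := derivative p + C c * p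

/-- Up to an exponential factor, the Wronskian of the functions `exp (c_i x) g_i(x)`, `i < k`. -/
def wr (φ : ℕ → ℂ × ℂ[X]) (k : ℕ) : ℂ[X] :=
  Matrix.det (Matrix.of fun i j : Fin k => (polyTwist (φ i).1)^[j] (φ i).2)

/-- Up to an exponential factor, the Wronskian of the functions `exp (c_i x) g_i(x)`, `i < k`,
and `exp (c x) y`. -/
def wrSnoc (φ : ℕ → ℂ × ℂ[X]) (k : ℕ) (c : ℂ) (y : ℂ[X]) : ℂ[X] :=
  Matrix.det (Matrix.of fun i j : Fin (k + 1) =>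
    (Fin.snoc (fun (i : Fin k) l => (polyTwist (φ i).1)^[l] (φ i).2)
      (fun l => (polyTwist c)^[l] y) : Fin (k + 1) → ℕ → ℂ[X]) i j)

theorem wrSnoc_self (φ : ℕ → ℂ × ℂ[X]) (k : ℕ) :
    wrSnoc φ k (φ k).1 (φ k).2 = wr φ (k + 1) := by
  unfold wrSnoc wr
  congr 1
  ext1 i j
  refine Fin.lastCases ?_ (fun i => ?_) i <;> simp

/-- `y` is an eigenfunction, with eigenvalue `l`, of `x y'' + (a - x) y'`, where the derivatives
are twisted by `c`. -/
def IsEigen (a c : ℂ) (y : ℂ[X]) (l : ℂ) : Prop :=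
  X * polyTwist c (polyTwist c y) + (C a - X) * polyTwist c y = C l * y

/-- The polynomial form of the chain: the two identities are the actions of `A` and `B` on `wrSnoc φ
k 0 y / wr φ k`, with denominators cleared. The first is Jacobi's identity for Wronskians. -/
theorem wr_chain (a : ℂ) (φ : ℕ → ℂ × ℂ[X]) (lam : ℕ → ℂ) (N : ℕ)
    (h0 : ∀ i < N, (φ i).2 ≠ 0) (hlam : ∀ i < N, ∀ j < i, lam i ≠ lam j)
    (hE : ∀ i < N, IsEigen a (φ i).1 (φ i).2 (lam i)) :
    (∀ k ≤ N, wr φ k ≠ 0) ∧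
    (∀ k < N, ∀ y, wr φ k * wrSnoc φ (k + 1) 0 y
      = derivative (wrSnoc φ k 0 y) * wr φ (k + 1) - C (φ k).1 * wr φ (k + 1) * wrSnoc φ k 0 y
        - derivative (wr φ (k + 1)) * wrSnoc φ k 0 y) ∧
    (∀ k < N, ∀ y l, IsEigen a 0 y l →
      X * derivative (wrSnoc φ (k + 1) 0 y) * wr φ k
        - X * derivative (wr φ k) * wrSnoc φ (k + 1) 0 y
        + ((C (φ k).1 - 1) * X + C (a + k)) * wr φ k * wrSnoc φ (k + 1) 0 y
      = C (l - lam k) * wrSnoc φ k 0 y * wr φ (k + 1)) := by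
  obtain ⟨D, hD⟩ := exists_derivation_extending (K := FractionRing ℂ[X])
    (Derivation.restrictScalars ℤ (derivative' (R := ℂ)))
  set ι : ℂ[X] →+* FractionRing ℂ[X] := algebraMap _ _ with hι
  have hinj : Function.Injective ι := IsFractionRing.injective _ _
  replace hD : ∀ p, D (ι p) = ι (derivative p) := hD
  have hne : ∀ p, p ≠ 0 → ι p ≠ 0 := fun p hp h => hp (hinj (by rw [h, map_zero]))
  have hC : ∀ z, D (ι (C z)) = 0 := fun z => by rw [hD]; simp
  have htw : ∀ c p, ι (polyTwist c p) = twist D (ι (C c)) (ι p) := fun c p => by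
    simp [polyTwist, twist, hD]
  have hit : ∀ c p j, ι ((polyTwist c)^[j] p) = (twist D (ι (C c)))^[j] (ι p) := by
    intro c p j
    induction j with
    | zero => rfl
    | succ j ih => rw [Function.iterate_succ_apply', htw, ih, Function.iterate_succ_apply']
  have hIs : ∀ c y l, IsEigen a c y l → ι X * twist D (ι (C c)) (twist D (ι (C c)) (ι y))
      + (ι (C a) - ι X) * twist D (ι (C c)) (ι y) = ι (C l) * ι y := by
    intro c y l h
    have := congrArg ι h
    simpa only [map_add, map_mul, map_sub, htw] using this
  set ψ : ℕ → FractionRing ℂ[X] × FractionRing ℂ[X] := fun i => (ι (C (φ i).1), ι (φ i).2) with hψ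
  have hx : D (ι X) = 1 := by rw [hD]; simp
  have chain := darboux_chain (D := D) hx (hC a) ψ (fun i => ι (C (lam i))) N
    (fun i hi => hne _ (h0 i hi)) (fun i hi => hC _)
    (fun i hi j hj h => hlam i hi j hj (C_injective (hinj h)))
    (fun i hi => hIs _ _ _ (hE i hi)) N le_rfl
  obtain ⟨-, -, hB⟩ := chain
  have hdet : ∀ k ≤ N, ∀ c y, ι (wrSnoc φ k c y) = darboux D ψ k (ι (C c)) (ι y) * ι (wr φ k) := by
    intro k hk c y
    obtain ⟨b, hb1, -, hb⟩ := darboux_eq_sum (D := D) ψ k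
    have h1 := det_snoc_eq_mul k (fun i l => ι ((polyTwist (φ i).1)^[l] (φ i).2))
      (fun l => ι ((polyTwist c)^[l] y)) b hb1 (by
        intro i
        have := darboux_seed (D := D) ψ k i i.2 (hB i (by omega)).1
        rw [hb] at this
        simpa only [hit] using this)
    rw [hb]
    simp only [hit] at h1
    unfold wrSnoc wr
    rw [RingHom.map_det, RingHom.map_det]
    refine Eq.trans ?_ (h1.trans ?_)
    · congr 1
      ext1 i j
      refine Fin.lastCases ?_ (fun i => ?_) i <;> simp [hit]
    · congr 2
      ext1 i j
      simp [hit]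
  have hwr : ∀ k < N, ι (wr φ (k + 1)) = darboux D ψ k (ψ k).1 (ψ k).2 * ι (wr φ k) := by
    intro k hk
    rw [← wrSnoc_self, hdet k hk.le]
  have hn : ∀ k ≤ N, wr φ k ≠ 0 := by
    intro k
    induction k with
    | zero => intro _; simp [wr]
    | succ k ih =>
      intro hk h
      have := hwr k (by omega)
      rw [h, map_zero] at this
      exact mul_ne_zero (hB k (by omega)).1 (hne _ (ih (by omega))) this.symm
  -- The transformed seed is `e^{cx} W_{k+1} / W_k`, with logarithmic derivative `c +
  -- W_{k+1}'/W_{k+1} - W_k'/W_k`.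
  have hlog : ∀ k < N, twist D (ψ k).1 (darboux D ψ k (ψ k).1 (ψ k).2)
      / darboux D ψ k (ψ k).1 (ψ k).2 * (ι (wr φ k) * ι (wr φ (k + 1)))
      = ι (C (φ k).1) * (ι (wr φ k) * ι (wr φ (k + 1)))
        + ι (derivative (wr φ (k + 1))) * ι (wr φ k) - ι (derivative (wr φ k)) * ι (wr φ (k + 1)) := by
    intro k hk
    have h1 := hwr k hk
    have h2 := congrArg D h1
    simp only [hD, Derivation.leibniz, smul_eq_mul] at h2
    have h3 := (hB k hk).1
    rw [h2, h1]
    simp only [twist]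
    field_simp
    ring
  refine ⟨hn, ?_, ?_⟩
  · intro k hk y
    apply hinj
    simp only [map_mul, map_sub, ← hD]
    rw [hdet k hk.le, hdet (k + 1) hk]
    have h1 := hlog k hk
    simp only [darboux, map_zero, Derivation.leibniz, smul_eq_mul, hD] at h1 ⊢
    simp only [twist] at h1 ⊢
    linear_combination (-darboux D ψ k 0 (ι y)) * h1
  · intro k hk y l hl
    apply hinj
    have h1 := hlog k hk
    have h2 := (hB k hk).2 _ _ _ (hC l) (hIs _ _ _ hl)
    simp only [map_mul, map_sub, map_add, ← hD, map_one, map_natCast]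
    rw [hdet k hk.le, hdet (k + 1) hk]
    simp only [map_zero, Derivation.leibniz, smul_eq_mul, hD] at h1 h2 ⊢
    set w := twist D (ψ k).1 (darboux D ψ k (ψ k).1 (ψ k).2) / darboux D ψ k (ψ k).1 (ψ k).2
    set y₁ := darboux D ψ (k + 1) 0 (ι y)
    simp only [twist, zero_mul, add_zero] at h2
    linear_combination ι (wr φ k) * ι (wr φ (k + 1)) * h2 - ι X * y₁ * h1

/-! ### Laguerre polynomials -/

theorem coeff_laguerre (α : ℂ) (n j : ℕ) : (laguerre α n).coeff j =
    if j ≤ n then (-1) ^ j / (j.factorial : ℂ) * Ring.choose ((n : ℂ) + α) (n - j) else 0 := by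
  simp only [laguerre, finsetSum_coeff, coeff_C_mul, coeff_X_pow, mul_ite, mul_one, mul_zero,
    Finset.sum_ite_eq, Finset.mem_range, Nat.lt_succ_iff]

theorem laguerre_zero (α : ℂ) : laguerre α 0 = 1 := by
  simp [laguerre]

theorem laguerre_ne_zero (α : ℂ) (n : ℕ) : laguerre α n ≠ 0 := by
  intro h
  have := coeff_laguerre α n n
  rw [h] at this
  simp only [coeff_zero, le_refl, if_true, Nat.sub_self, Ring.choose_zero_right, mul_one] at this
  exact div_ne_zero (pow_ne_zero _ (by norm_num))
    (Nat.cast_ne_zero.2 n.factorial_ne_zero) this.symm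

theorem derivative_laguerre_succ (α : ℂ) (n : ℕ) :
    derivative (laguerre α (n + 1)) = -laguerre (α + 1) n := by
  ext j
  rw [coeff_derivative, coeff_neg, coeff_laguerre, coeff_laguerre]
  simp only [Nat.add_le_add_iff_right, Nat.add_sub_add_right]
  split_ifs with h
  · have h1 : ((j.factorial : ℕ) : ℂ) ≠ 0 := Nat.cast_ne_zero.2 j.factorial_ne_zero
    have h2 : (j : ℂ) + 1 ≠ 0 := Nat.cast_add_one_ne_zero j
    rw [Nat.factorial_succ]
    push_cast
    rw [show (n : ℂ) + 1 + α = n + (α + 1) by ring]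
    field_simp
    ring
  · simp

theorem laguerre_add_one (α : ℂ) (n : ℕ) :
    laguerre (α + 1) n = laguerre α n - derivative (laguerre α n) := by
  cases n with
  | zero => simp [laguerre_zero]
  | succ n =>
    rw [derivative_laguerre_succ, sub_neg_eq_add]
    ext j
    rw [coeff_add, coeff_laguerre, coeff_laguerre, coeff_laguerre]
    rcases lt_trichotomy j (n + 1) with h | h | h
    · rw [if_pos h.le, if_pos h.le, if_pos (by omega), Nat.succ_sub (by omega)]
      push_cast
      rw [show (n : ℂ) + 1 + (α + 1) = n + 1 + α + 1 by ring, Nat.succ_eq_add_one,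
        Ring.choose_succ_succ, show (n : ℂ) + (α + 1) = n + 1 + α by ring]
      ring
    · subst h
      simp
    · rw [if_neg (by omega), if_neg (by omega), if_neg (by omega)]
      simp

theorem succ_mul_choose_succ (r : ℂ) (k : ℕ) :
    ((k : ℂ) + 1) * Ring.choose r (k + 1) = (r - k) * Ring.choose r k := by
  rw [Ring.choose_eq_smul, Ring.choose_eq_smul, descPochhammer_succ_right]
  have h1 : ((k.factorial : ℕ) : ℂ) ≠ 0 := Nat.cast_ne_zero.2 k.factorial_ne_zero
  have h2 : (k : ℂ) + 1 ≠ 0 := Nat.cast_add_one_ne_zero k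
  rw [Nat.factorial_succ, smeval_mul, smeval_sub, smeval_X, smeval_natCast]
  simp only [smul_eq_mul]
  push_cast
  field_simp
  simp

theorem laguerre_ode (α : ℂ) (n : ℕ) :
    X * derivative (derivative (laguerre α n)) + (C (α + 1) - X) * derivative (laguerre α n)
      = -C (n : ℂ) * laguerre α n := by
  ext j
  -- The differential equation read coefficientwise is this two-term recurrence.
  have key : ((j : ℂ) + 1) * ((j : ℂ) + α + 1) * (laguerre α n).coeff (j + 1)
      = ((j : ℂ) - n) * (laguerre α n).coeff j := by
    rw [coeff_laguerre, coeff_laguerre]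
    rcases lt_trichotomy j n with h | h | h
    · obtain ⟨d, rfl⟩ := Nat.exists_eq_add_of_lt h
      rw [if_pos (by omega), if_pos (by omega)]
      have h1 := succ_mul_choose_succ ((j + d + 1 : ℕ) + α) d
      rw [show j + d + 1 - (j + 1) = d by omega, show j + d + 1 - j = d + 1 by omega,
        Nat.factorial_succ]
      have h2 : ((j.factorial : ℕ) : ℂ) ≠ 0 := Nat.cast_ne_zero.2 j.factorial_ne_zero
      have h3 : (j : ℂ) + 1 ≠ 0 := Nat.cast_add_one_ne_zero j
      push_cast at h1 ⊢
      field_simp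
      linear_combination (-1) ^ j * h1
    · subst h; simp
    · rw [if_neg (by omega), if_neg (by omega)]; simp
  have e1 : (X * derivative (derivative (laguerre α n))).coeff j
      = j * ((j : ℂ) + 1) * (laguerre α n).coeff (j + 1) := by
    cases j with
    | zero => simp
    | succ j => rw [coeff_X_mul, coeff_derivative, coeff_derivative]; push_cast; ring
  have e2 : (X * derivative (laguerre α n)).coeff j = j * (laguerre α n).coeff j := by
    cases j with
    | zero => simp
    | succ j => rw [coeff_X_mul, coeff_derivative]; push_cast; ring
  rw [sub_mul, coeff_add, coeff_sub, e1, e2, neg_mul, coeff_neg, coeff_C_mul, coeff_C_mul,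
    coeff_derivative]
  linear_combination key

theorem isEigen_laguerre (α : ℂ) (n : ℕ) : IsEigen (α + 1) 0 (laguerre α n) (-n) := by
  have := laguerre_ode α n
  simpa [IsEigen, polyTwist] using this

theorem derivative_comp_neg_X (p : ℂ[X]) :
    derivative (p.comp (-X)) = -(derivative p).comp (-X) := by
  rw [derivative_comp]; simp

theorem isEigen_laguerre_comp_neg (α : ℂ) (n : ℕ) :
    IsEigen (α + 1) 1 ((laguerre α n).comp (-X)) (α + 1 + n) := by
  have h := congrArg (fun p => p.comp (-X)) (laguerre_ode α n)
  simp only [add_comp, mul_comp, sub_comp, X_comp, C_comp, neg_comp] at h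
  simp only [IsEigen, polyTwist, derivative_add, derivative_comp_neg_X, derivative_neg, C_1,
    one_mul, C_add] at h ⊢
  linear_combination -h

/-- By `laguerre_add_one`, raising `α` by one amounts to differentiating `e^x L_n^α(-x)`; this turns
the `F₂` rows into Wronskian rows. -/
theorem laguerre_add_natCast_comp_neg (α : ℂ) (n j : ℕ) :
    (laguerre (α + j) n).comp (-X) = (polyTwist 1)^[j] ((laguerre α n).comp (-X)) := by
  induction j with
  | zero => simp
  | succ j ih =>
    rw [Function.iterate_succ_apply', ← ih, Nat.cast_succ, ← add_assoc, laguerre_add_one]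
    simp only [polyTwist, derivative_comp_neg_X, sub_comp, C_1]
    ring

theorem polyTwist_zero_iterate (p : ℂ[X]) (j : ℕ) : (polyTwist 0)^[j] p = derivative^[j] p := by
  congr 1
  ext1 q
  simp [polyTwist]

section Integration

open Filter Topology Asymptotics MeasureTheory

/-! ### Calculus along the path -/

section Path

variable {r : ℝ}

theorem line_mem_pathSet {t x : ℝ} (ht : |t| = r) (hx : 0 ≤ x) :
    (x + t * Complex.I : ℂ) ∈ pathSet r := by
  left; simp [ht, hx]

theorem arcPoint_mem_pathSet (hr : 0 < r) {θ : ℝ}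
    (h : θ ∈ Set.Icc (Real.pi / 2) (3 * Real.pi / 2)) : arcPoint r θ ∈ pathSet r := by
  right
  have hc : Real.cos θ ≤ 0 := Real.cos_nonpos_of_pi_div_two_le_of_le h.1 (by linarith [h.2])
  refine ⟨?_, ?_⟩
  · rw [arcPoint, Complex.re_ofReal_mul, Complex.exp_ofReal_mul_I_re]
    exact mul_nonpos_of_nonneg_of_nonpos hr.le hc
  · rw [arcPoint, norm_mul, Complex.norm_exp_ofReal_mul_I, Complex.norm_real, mul_one,
      Real.norm_of_nonneg hr.le]

theorem neg_mem_slitPlane (hr : 0 < r) {z : ℂ} (hz : z ∈ pathSet r) : -z ∈ Complex.slitPlane := by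
  rw [Complex.mem_slitPlane_iff, Complex.neg_re, Complex.neg_im]
  rcases hz with ⟨-, h⟩ | ⟨h1, h2⟩
  · right
    intro h0
    rw [neg_eq_zero.1 h0, abs_zero] at h
    exact hr.ne h
  · rcases h1.lt_or_eq with h | h
    · left; linarith
    · right
      intro h0
      have : z = 0 := Complex.ext h (neg_eq_zero.1 h0)
      rw [this, norm_zero] at h2
      exact hr.ne h2

theorem ne_zero_of_mem_pathSet (hr : 0 < r) {z : ℂ} (hz : z ∈ pathSet r) : z ≠ 0 :=
  neg_ne_zero.1 (Complex.slitPlane_ne_zero (neg_mem_slitPlane hr hz))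

theorem branchPow_add_one {z : ℂ} (hz : z ≠ 0) (a : ℂ) :
    branchPow z (a + 1) = z * branchPow z a := by
  have h : Complex.exp (branchLog z) = z := by
    rw [branchLog, Complex.exp_add, Complex.exp_log (neg_ne_zero.2 hz), Complex.exp_pi_mul_I]
    ring
  rw [branchPow, branchPow, add_mul, one_mul, Complex.exp_add, h, mul_comm]

theorem hasDerivAt_branchPow {z : ℂ} (hz : -z ∈ Complex.slitPlane) (a : ℂ) :
    HasDerivAt (fun z => branchPow z a) (a * branchPow z (a - 1)) z := by
  have h0 : z ≠ 0 := neg_ne_zero.1 (Complex.slitPlane_ne_zero hz)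
  have h1 : HasDerivAt branchLog (1 / z) z := by
    have := ((hasDerivAt_neg z).clog hz).add_const (Real.pi * Complex.I)
    rwa [neg_div_neg_eq] at this
  have h2 := (h1.const_mul a).cexp
  have h3 := branchPow_add_one h0 (a - 1)
  rw [sub_add_cancel] at h3
  convert! h2 using 1
  change _ = branchPow z a * _
  rw [h3]
  field_simp

/-- The values of `G` at the junctions `± r i` cancel, leaving the two limits at infinity. -/
theorem pathIntegral_of_hasDerivAt (hr : 0 < r) {G g : ℂ → ℂ} {l₁ l₂ : ℂ}
    (hG : ∀ z ∈ pathSet r, HasDerivAt G (g z) z) (hg : PathIntegrable r g)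
    (h₁ : Tendsto (fun x : ℝ => G (x + r * Complex.I)) atTop (𝓝 l₁))
    (h₂ : Tendsto (fun x : ℝ => G (x - r * Complex.I)) atTop (𝓝 l₂)) :
    pathIntegral r g = l₂ - l₁ := by
  have hline : ∀ t : ℝ, |t| = r → ∀ x ∈ Set.Ici (0 : ℝ),
      HasDerivAt (fun x : ℝ => G (x + t * Complex.I)) (g (x + t * Complex.I)) x := by
    intro t ht x hx
    have h1 := hG _ (line_mem_pathSet ht hx)
    have h2 : HasDerivAt (fun y : ℂ => y + t * Complex.I) 1 (x : ℂ) :=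
      (hasDerivAt_id _).add_const _
    have h3 := (HasDerivAt.comp (x : ℂ) h1 h2).comp_ofReal
    rw [mul_one] at h3
    exact h3
  have e1 := integral_Ioi_of_hasDerivAt_of_tendsto' (hline r (abs_of_pos hr)) hg.1 h₁
  have hsub : ∀ x : ℝ, (x : ℂ) - r * Complex.I = x + ((-r : ℝ) : ℂ) * Complex.I := by
    intro x; push_cast; ring
  have e2 := integral_Ioi_of_hasDerivAt_of_tendsto' (hline (-r) (by rw [abs_neg, abs_of_pos hr]))
    (by simpa only [hsub] using hg.2.2) (by simpa only [hsub] using h₂)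
  have e3 : ∫ θ in (Real.pi / 2)..(3 * Real.pi / 2),
      g (arcPoint r θ) * (Complex.I * arcPoint r θ)
      = G (arcPoint r (3 * Real.pi / 2)) - G (arcPoint r (Real.pi / 2)) := by
    refine intervalIntegral.integral_eq_sub_of_hasDerivAt (f := fun θ => G (arcPoint r θ))
      (fun θ hθ => ?_) hg.2.1
    rw [Set.uIcc_of_le (by linarith [Real.pi_pos])] at hθ
    have h1 := hG _ (arcPoint_mem_pathSet hr hθ)
    have h2 : HasDerivAt (fun y : ℂ => (r : ℂ) * Complex.exp (y * Complex.I))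
        (r * (Complex.exp (θ * Complex.I) * (1 * Complex.I))) (θ : ℂ) :=
      (((hasDerivAt_id (θ : ℂ)).mul_const Complex.I).cexp).const_mul _
    have h3 := (HasDerivAt.comp (θ : ℂ) h1 h2).comp_ofReal
    convert! h3 using 1
    simp only [arcPoint]
    ring
  have p1 : arcPoint r (Real.pi / 2) = r * Complex.I := by
    simp [arcPoint, Complex.exp_pi_div_two_mul_I]
  have p2 : arcPoint r (3 * Real.pi / 2) = -(r * Complex.I) := by
    have : ((3 * Real.pi / 2 : ℝ) : ℂ) * Complex.I
        = Real.pi / 2 * Complex.I + Real.pi * Complex.I := by push_cast; ring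
    rw [arcPoint, this, Complex.exp_add, Complex.exp_pi_mul_I, Complex.exp_pi_div_two_mul_I]
    ring
  rw [pathIntegral]
  simp only [hsub]
  rw [e1, e2, e3, p1, p2]
  simp

theorem pathIntegral_sub_const_mul {f g : ℂ → ℂ} (hf : PathIntegrable r f)
    (hg : PathIntegrable r g) (c : ℂ) :
    pathIntegral r (fun z => f z - c * g z) = pathIntegral r f - c * pathIntegral r g := by
  unfold pathIntegral
  simp only [sub_mul, mul_assoc]
  rw [integral_sub hf.1 (hg.1.const_mul c), integral_sub hf.2.2 (hg.2.2.const_mul c),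
    intervalIntegral.integral_sub hf.2.1 (hg.2.1.const_mul c), integral_const_mul,
    integral_const_mul, intervalIntegral.integral_const_mul]
  ring

theorem PathIntegrable.sub_const_mul {f g : ℂ → ℂ} (hf : PathIntegrable r f)
    (hg : PathIntegrable r g) (c : ℂ) : PathIntegrable r (fun z => f z - c * g z) := by
  refine ⟨hf.1.sub (hg.1.const_mul c), ?_, hf.2.2.sub (hg.2.2.const_mul c)⟩
  simp only [sub_mul, mul_assoc]
  exact hf.2.1.sub (hg.2.1.const_mul c)

end Path

/-! ### Growth estimates and integration by parts -/

section Growth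

/-- Growth slower than every increasing exponential. -/
def SubExp (f : ℝ → ℂ) : Prop := ∀ ε : ℝ, 0 < ε → f =O[atTop] fun x => Real.exp (ε * x)

theorem SubExp.mul {f g : ℝ → ℂ} (hf : SubExp f) (hg : SubExp g) :
    SubExp (fun x => f x * g x) := by
  intro ε hε
  refine ((hf (ε / 2) (half_pos hε)).mul (hg (ε / 2) (half_pos hε))).congr_right fun x => ?_
  rw [← Real.exp_add]
  ring_nf

theorem SubExp.add {f g : ℝ → ℂ} (hf : SubExp f) (hg : SubExp g) :
    SubExp (fun x => f x + g x) :=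
  fun ε hε => (hf ε hε).add (hg ε hε)

theorem subExp_of_eventually_le {f : ℝ → ℂ} {c : ℝ} (h : ∀ᶠ x in atTop, ‖f x‖ ≤ c) :
    SubExp f := by
  intro ε hε
  have h1 : f =O[atTop] fun _ => (1 : ℝ) :=
    IsBigO.of_bound c (by simpa using h)
  refine h1.trans (IsBigO.of_bound 1 ?_)
  filter_upwards [eventually_ge_atTop 0] with x hx
  rw [one_mul, norm_one, Real.norm_of_nonneg (Real.exp_pos _).le]
  exact Real.one_le_exp (by positivity)

theorem subExp_const (c : ℂ) : SubExp (fun _ => c) :=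
  subExp_of_eventually_le (Eventually.of_forall fun _ => le_rfl)

theorem subExp_line (t : ℝ) : SubExp (fun x : ℝ => (x + t * Complex.I : ℂ)) := by
  refine SubExp.add (fun ε hε => ?_) (subExp_const _)
  have := (isLittleO_pow_exp_pos_mul_atTop 1 hε).isBigO
  refine IsBigO.trans (IsBigO.of_bound 1 (Eventually.of_forall fun x => ?_)) this
  simp

theorem subExp_eval (p : ℂ[X]) (t : ℝ) :
    SubExp (fun x : ℝ => p.eval (x + t * Complex.I : ℂ)) := by
  induction p using Polynomial.induction_on' with
  | add p q hp hq => simpa only [eval_add] using hp.add hq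
  | monomial n a =>
    induction n with
    | zero => simpa using subExp_const a
    | succ n ih =>
      have := ih.mul (subExp_line t)
      simpa only [eval_monomial, pow_succ, mul_assoc] using this

theorem tendsto_norm_line (t : ℝ) :
    Tendsto (fun x : ℝ => ‖(x + t * Complex.I : ℂ)‖) atTop atTop := by
  refine tendsto_atTop_mono (fun x => ?_) tendsto_id
  have := Complex.re_le_norm (x + t * Complex.I : ℂ)
  simpa using this

/-- A nonconstant polynomial tends to infinity in norm along the line, so its inverse is eventually
bounded; constants, including `0⁻¹ = 0`, are trivial. -/
theorem subExp_inv_eval (p : ℂ[X]) (t : ℝ) :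
    SubExp (fun x : ℝ => (p.eval (x + t * Complex.I : ℂ))⁻¹) := by
  rcases le_or_gt p.degree 0 with h | h
  · rw [eq_C_of_degree_le_zero h]
    simpa using subExp_const _
  · have h1 := p.tendsto_norm_atTop h (tendsto_norm_line t)
    refine subExp_of_eventually_le (c := 1) ?_
    filter_upwards [h1.eventually_ge_atTop 1] with x hx
    rw [norm_inv]
    exact inv_le_one_of_one_le₀ hx

theorem norm_branchPow_le (z a : ℂ) :
    ‖branchPow z a‖ ≤ Real.exp (‖a‖ * (|Real.log ‖z‖| + 2 * Real.pi)) := by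
  rw [branchPow, Complex.norm_exp, Real.exp_le_exp]
  refine (Complex.re_le_norm _).trans ?_
  rw [norm_mul]
  refine mul_le_mul_of_nonneg_left ?_ (norm_nonneg _)
  rw [branchLog]
  refine (norm_add_le _ _).trans ?_
  have h1 := Complex.norm_le_abs_re_add_abs_im (Complex.log (-z))
  rw [Complex.log_re, Complex.log_im, norm_neg] at h1
  have h2 := Complex.abs_arg_le_pi (-z)
  have h3 : ‖(Real.pi * Complex.I : ℂ)‖ = Real.pi := by
    simp [abs_of_pos Real.pi_pos]
  linarith

theorem subExp_branchPow (a : ℂ) (t : ℝ) :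
    SubExp (fun x : ℝ => branchPow (x + t * Complex.I : ℂ) a) := by
  intro ε hε
  have hl : (fun x => ‖a‖ * (Real.log x + (Real.log 2 + 2 * Real.pi))) =o[atTop] (id : ℝ → ℝ) :=
    (Real.isLittleO_log_id_atTop.add (isLittleO_const_id_atTop _)).const_mul_left _
  refine IsBigO.of_bound 1 ?_
  filter_upwards [hl.def hε, eventually_ge_atTop 1, eventually_ge_atTop |t|] with x h1 h2 h3
  rw [one_mul, Real.norm_of_nonneg (Real.exp_pos _).le]
  refine (norm_branchPow_le _ _).trans (Real.exp_le_exp.2 ?_)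
  have n1 : 1 ≤ ‖(x + t * Complex.I : ℂ)‖ := by
    have := Complex.re_le_norm (x + t * Complex.I : ℂ)
    simp at this
    linarith
  have n2 : ‖(x + t * Complex.I : ℂ)‖ ≤ 2 * x := by
    have := Complex.norm_le_abs_re_add_abs_im (x + t * Complex.I : ℂ)
    simp at this
    rw [abs_of_nonneg (by linarith : 0 ≤ x)] at this
    linarith
  have h4 : |Real.log ‖(x + t * Complex.I : ℂ)‖| ≤ Real.log x + Real.log 2 := by
    rw [abs_of_nonneg (Real.log_nonneg n1), add_comm (Real.log x),
      ← Real.log_mul two_ne_zero (by linarith)]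
    exact Real.log_le_log (by linarith) n2
  have h5 := (le_abs_self _).trans h1
  rw [id, Real.norm_of_nonneg (by linarith)] at h5
  refine le_trans (mul_le_mul_of_nonneg_left ?_ (norm_nonneg _)) h5
  linarith

/-- Continuity on `Λ_r`, with subexponential growth on its half lines. -/
def Moderate (r : ℝ) (R : ℂ → ℂ) : Prop :=
  ContinuousOn R (pathSet r) ∧ ∀ t : ℝ, SubExp (fun x : ℝ => R (x + t * Complex.I))

variable {r : ℝ}

theorem Moderate.mul {f g : ℂ → ℂ} (hf : Moderate r f) (hg : Moderate r g) :
    Moderate r (fun z => f z * g z) :=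
  ⟨hf.1.mul hg.1, fun t => (hf.2 t).mul (hg.2 t)⟩

theorem moderate_eval (p : ℂ[X]) : Moderate r (fun z => p.eval z) :=
  ⟨p.continuous.continuousOn, subExp_eval p⟩

theorem moderate_inv_eval {p : ℂ[X]} (hp : ∀ z ∈ pathSet r, p.eval z ≠ 0) :
    Moderate r (fun z => (p.eval z)⁻¹) := by
  exact ⟨p.continuous.continuousOn.inv₀ hp, subExp_inv_eval p⟩

theorem moderate_branchPow (hr : 0 < r) (a : ℂ) : Moderate r (fun z => branchPow z a) :=
  ⟨fun _ hz => (hasDerivAt_branchPow (neg_mem_slitPlane hr hz) a).continuousAt.continuousWithinAt,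
    subExp_branchPow a⟩

theorem Moderate.isBigO_line {R : ℂ → ℂ} (hR : Moderate r R) (t : ℝ) :
    (fun x : ℝ => R (x + t * Complex.I) * Complex.exp (-(x + t * Complex.I)))
      =O[atTop] fun x => Real.exp (-(1 / 2) * x) := by
  have h1 := hR.2 t (1 / 2) (by norm_num)
  have h2 : (fun x : ℝ => Complex.exp (-(x + t * Complex.I))) =O[atTop] fun x => Real.exp (-x) := by
    refine IsBigO.of_bound 1 (Eventually.of_forall fun x => ?_)
    rw [Complex.norm_exp, one_mul, Real.norm_of_nonneg (Real.exp_pos _).le]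
    simp
  refine (h1.mul h2).congr_right fun x => ?_
  rw [← Real.exp_add]
  ring_nf

theorem Moderate.tendsto_line {R : ℂ → ℂ} (hR : Moderate r R) (t : ℝ) :
    Tendsto (fun x : ℝ => R (x + t * Complex.I) * Complex.exp (-(x + t * Complex.I)))
      atTop (𝓝 0) := by
  refine (hR.isBigO_line t).trans_tendsto ?_
  exact Real.tendsto_exp_atBot.comp (tendsto_id.const_mul_atTop_of_neg (by norm_num))

theorem Moderate.pathIntegrable (hr : 0 < r) {R : ℂ → ℂ} (hR : Moderate r R) :
    PathIntegrable r (fun z => R z * Complex.exp (-z)) := by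
  have hc : ContinuousOn (fun z => R z * Complex.exp (-z)) (pathSet r) :=
    hR.1.mul (by fun_prop)
  have hline : ∀ t : ℝ, |t| = r →
      IntegrableOn (fun x : ℝ => R (x + t * Complex.I) * Complex.exp (-(x + t * Complex.I)))
        (Set.Ioi 0) := by
    intro t ht
    refine (integrableOn_Ici_iff_integrableOn_Ioi (by finiteness)).mp
      ((ContinuousOn.locallyIntegrableOn ?_ measurableSet_Ici).integrableOn_of_isBigO_atTop
      (hR.isBigO_line t) ⟨Set.Ioi 0, Ioi_mem_atTop 0, exp_neg_integrableOn_Ioi 0 (by norm_num)⟩)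
    exact hc.comp (f := fun x : ℝ => (x + t * Complex.I : ℂ)) (by fun_prop)
      fun x hx => line_mem_pathSet ht hx
  refine ⟨hline r (abs_of_pos hr), ?_, ?_⟩
  · refine ContinuousOn.intervalIntegrable ?_
    rw [Set.uIcc_of_le (by linarith [Real.pi_pos])]
    have ha : Continuous (arcPoint r) := by unfold arcPoint; fun_prop
    exact (hc.comp ha.continuousOn fun θ hθ => arcPoint_mem_pathSet hr hθ).mul
      (by fun_prop)
  · have := hline (-r) (by rw [abs_neg, abs_of_pos hr])
    simpa [sub_eq_add_neg] using this

/-- Integration of an exact derivative along `Λ_r`. -/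
theorem pathIntegral_eq_zero (hr : 0 < r) {R g : ℂ → ℂ} (hR : Moderate r R)
    (hg : PathIntegrable r g)
    (hG : ∀ z ∈ pathSet r, HasDerivAt (fun z => R z * Complex.exp (-z)) (g z) z) :
    pathIntegral r g = 0 := by
  have := pathIntegral_of_hasDerivAt hr hG hg (hR.tendsto_line r)
    (by simpa [sub_eq_add_neg] using hR.tendsto_line (-r))
  simpa using this

theorem pathIntegrable_rational (hr : 0 < r) (a : ℂ) (P Q : ℂ[X]) {U : ℂ[X]}
    (hU : ∀ z ∈ pathSet r, U.eval z ≠ 0) :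
    PathIntegrable r (fun z => P.eval z * Q.eval z
      * (branchPow z a * Complex.exp (-z) / U.eval z ^ 2)) := by
  have h := ((((moderate_eval P).mul (moderate_eval Q)).mul (moderate_branchPow hr a)).mul
    ((moderate_inv_eval hU).mul (moderate_inv_eval hU))).pathIntegrable hr
  convert! h using 2 with z
  rw [div_eq_mul_inv, sq, mul_inv]
  ring

/-- One integration by parts moves `A` from `Q` onto `P₁` as `-B`. Here `hQ` is the action of `A`,
and `hP` says that `B` returns `P₁` to `mu` times `P`. -/
theorem pathIntegral_darboux_step (hr : 0 < r) (a c mu : ℂ) {U V P P₁ Q Q₁ : ℂ[X]}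
    (hU : ∀ z ∈ pathSet r, U.eval z ≠ 0) (hV : ∀ z ∈ pathSet r, V.eval z ≠ 0)
    (hQ : U * Q₁ = derivative Q * V - C c * V * Q - derivative V * Q)
    (hP : X * derivative P₁ * U - X * derivative U * P₁ + ((C c - 1) * X + C a) * U * P₁
      = C mu * P * V) :
    pathIntegral r (fun z => P₁.eval z * Q₁.eval z
      * (branchPow z a * Complex.exp (-z) / V.eval z ^ 2))
    = -mu * pathIntegral r (fun z => P.eval z * Q.eval z
      * (branchPow z (a - 1) * Complex.exp (-z) / U.eval z ^ 2)) := by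
  have h1 := pathIntegrable_rational hr a P₁ Q₁ hV
  have h2 := pathIntegrable_rational hr (a - 1) P Q hU
  -- The boundary term; its derivative, with the factor `e^{-z}`, is the first integrand plus `mu`
  -- times the second.
  have hR : Moderate r (fun z => P₁.eval z * Q.eval z * branchPow z a
      * ((V.eval z)⁻¹ * (U.eval z)⁻¹)) :=
    (((moderate_eval P₁).mul (moderate_eval Q)).mul (moderate_branchPow hr a)).mul
      ((moderate_inv_eval hV).mul (moderate_inv_eval hU))
  have := pathIntegral_eq_zero hr hR (h1.sub_const_mul h2 (-mu)) (fun z hz => ?_)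
  · rw [pathIntegral_sub_const_mul h1 h2] at this
    exact sub_eq_zero.1 this
  · have u0 := hU z hz
    have v0 := hV z hz
    have z0 := ne_zero_of_mem_pathSet hr hz
    have d1 := ((P₁.hasDerivAt z).mul (Q.hasDerivAt z)).mul
      (hasDerivAt_branchPow (neg_mem_slitPlane hr hz) a)
    have d2 := ((V.hasDerivAt z).inv v0).mul ((U.hasDerivAt z).inv u0)
    have d3 := (d1.mul d2).mul (hasDerivAt_neg z).cexp
    convert! d3 using 1
    have e1 := congrArg (fun p => p.eval z) hQ
    have e2 := congrArg (fun p => p.eval z) hP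
    simp only [eval_mul, eval_sub, eval_add, eval_X, eval_C, eval_one] at e1 e2
    have e3 := branchPow_add_one z0 (a - 1)
    rw [sub_add_cancel] at e3
    simp only [Pi.mul_apply, Pi.inv_apply]
    rw [e3]
    generalize branchPow z (a - 1) = w
    generalize Complex.exp (-z) = E
    field_simp
    linear_combination w * E * eval z P₁ * z * eval z U * e1 - w * E * eval z Q * eval z V * e2

end Growth

/-! ### The Gamma integral and Laguerre orthogonality on the path -/

section Gamma

/-- The entire function `∑ (-z)^n / (n! (n + s + 1))`, a factor of the lower incomplete gamma
function. -/
theorem exists_entire_incomplete_gamma_factor {s : ℂ} (hs : 0 ≤ s.re) :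
    ∃ M M' : ℂ → ℂ, ∀ z, HasDerivAt M (M' z) z ∧ z * M' z + (s + 1) * M z = Complex.exp (-z) := by
  let c : ℕ → ℂ := fun n => (-1) ^ n / (n.factorial * (n + s + 1))
  have hd : ∀ n : ℕ, 1 ≤ ‖(n + s + 1 : ℂ)‖ := by
    intro n
    refine le_trans ?_ (Complex.re_le_norm _)
    simp
    positivity
  have hne : ∀ n : ℕ, (n + s + 1 : ℂ) ≠ 0 := fun n h => by
    have := hd n
    rw [h, norm_zero] at this
    linarith
  have hc : ∀ n, ‖c n‖ ≤ 1 / n.factorial := by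
    intro n
    have h1 : (0 : ℝ) < n.factorial := by positivity
    simp only [c, norm_div, norm_pow, norm_neg, norm_one, one_pow, norm_mul, Complex.norm_natCast]
    refine one_div_le_one_div_of_le h1 ?_
    nlinarith [hd n]
  have hsum : ∀ z : ℂ, Summable fun n => c n * z ^ n := by
    intro z
    refine Summable.of_norm_bounded (Real.summable_pow_div_factorial ‖z‖) fun n => ?_
    rw [norm_mul, norm_pow]
    calc _ ≤ 1 / n.factorial * ‖z‖ ^ n := by gcongr; exact hc n
      _ = _ := by ring
  have hder : ∀ z : ℂ, HasDerivAt (fun z => ∑' n, c n * z ^ n)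
      (∑' n : ℕ, c n * (n * z ^ (n - 1))) z ∧ Summable fun n : ℕ => c n * (n * z ^ (n - 1)) := by
    intro z
    have hu : Summable fun n : ℕ => (1 / n.factorial : ℝ) * (n * (‖z‖ + 1) ^ (n - 1)) := by
      rw [← summable_nat_add_iff 1]
      refine (Real.summable_pow_div_factorial (‖z‖ + 1)).congr fun n => ?_
      have h1 : (n.factorial : ℝ) ≠ 0 := by positivity
      have h2 : (n : ℝ) + 1 ≠ 0 := by positivity
      rw [Nat.factorial_succ, Nat.add_sub_cancel]
      push_cast
      field_simp
    have hb : ∀ (n : ℕ), ∀ y ∈ Metric.ball (0 : ℂ) (‖z‖ + 1), ‖c n * (n * y ^ (n - 1))‖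
        ≤ (1 / n.factorial : ℝ) * (n * (‖z‖ + 1) ^ (n - 1)) := by
      intro n y hy
      rw [norm_mul, norm_mul, norm_pow, Complex.norm_natCast]
      have hy' : ‖y‖ ≤ ‖z‖ + 1 := (mem_ball_zero_iff.1 hy).le
      gcongr
      exact hc n
    have hz : z ∈ Metric.ball (0 : ℂ) (‖z‖ + 1) := by simp
    refine ⟨hasDerivAt_tsum_of_isPreconnected hu Metric.isOpen_ball
      (convex_ball (0 : ℂ) _).isPreconnected
      (fun n y _ => (hasDerivAt_pow n y).const_mul (c n)) hb hz (hsum z) hz,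
      Summable.of_norm_bounded hu fun n => hb n z hz⟩
  refine ⟨_, _, fun z => ⟨(hder z).1, ?_⟩⟩
  rw [← tsum_mul_left, ← tsum_mul_left,
    ← ((hder z).2.mul_left z).tsum_add ((hsum z).mul_left (s + 1)),
    Complex.exp_eq_exp_ℂ, ← (NormedSpace.expSeries_div_hasSum_exp (-z)).tsum_eq]
  refine tsum_congr fun n => ?_
  have h1 : (n.factorial : ℂ) ≠ 0 := Nat.cast_ne_zero.2 n.factorial_ne_zero
  have h2 := hne n
  have h3 : z * (n * z ^ (n - 1)) = n * z ^ n := by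
    cases n with
    | zero => simp
    | succ n => rw [Nat.add_sub_cancel]; ring
  rw [show z * (c n * (n * z ^ (n - 1))) = c n * (z * (n * z ^ (n - 1))) by ring, h3, neg_pow]
  simp only [c]
  field_simp
  ring

theorem norm_cpow_le_exp {z : ℂ} (hz : z ≠ 0) (s : ℂ) :
    ‖z ^ s‖ ≤ Real.exp (‖s‖ * (|Real.log ‖z‖| + Real.pi)) := by
  rw [Complex.cpow_def_of_ne_zero hz, Complex.norm_exp, Real.exp_le_exp, mul_comm]
  refine (Complex.re_le_norm _).trans ?_
  rw [norm_mul]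
  refine mul_le_mul_of_nonneg_left ?_ (norm_nonneg _)
  have h1 := Complex.norm_le_abs_re_add_abs_im (Complex.log z)
  rw [Complex.log_re, Complex.log_im] at h1
  linarith [Complex.abs_arg_le_pi z]

theorem eventually_norm_cpow_mul_exp_le (s : ℂ) (t : ℝ) : ∀ᶠ x : ℝ in atTop, ∀ u : ℝ, |u| ≤ |t| →
    ‖(x + u * Complex.I : ℂ) ^ s * Complex.exp (-(x + u * Complex.I))‖
      ≤ Real.exp (-(1 / 2) * x) := by
  have hl : (fun x => ‖s‖ * (Real.log x + (Real.log 2 + Real.pi))) =o[atTop] (id : ℝ → ℝ) :=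
    (Real.isLittleO_log_id_atTop.add (isLittleO_const_id_atTop _)).const_mul_left _
  filter_upwards [hl.def (by norm_num : (0 : ℝ) < 1 / 2), eventually_ge_atTop 1,
    eventually_ge_atTop |t|] with x h1 h2 h3 u hu
  have n1 : 1 ≤ ‖(x + u * Complex.I : ℂ)‖ := by
    have := Complex.re_le_norm (x + u * Complex.I : ℂ)
    simp at this
    linarith
  have n2 : ‖(x + u * Complex.I : ℂ)‖ ≤ 2 * x := by
    have := Complex.norm_le_abs_re_add_abs_im (x + u * Complex.I : ℂ)
    simp at this
    rw [abs_of_nonneg (by linarith : 0 ≤ x)] at this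
    linarith
  have h4 : |Real.log ‖(x + u * Complex.I : ℂ)‖| ≤ Real.log x + Real.log 2 := by
    rw [abs_of_nonneg (Real.log_nonneg n1), add_comm (Real.log x),
      ← Real.log_mul two_ne_zero (by linarith)]
    exact Real.log_le_log (by linarith) n2
  have h5 := (le_abs_self _).trans h1
  rw [id, Real.norm_of_nonneg (by linarith)] at h5
  have h6 := norm_cpow_le_exp (norm_pos_iff.1 (by linarith : 0 < ‖(x + u * Complex.I : ℂ)‖)) s
  rw [norm_mul, Complex.norm_exp]
  refine (mul_le_mul_of_nonneg_right h6 (Real.exp_pos _).le).trans ?_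
  rw [← Real.exp_add, Real.exp_le_exp]
  have h7 := mul_le_mul_of_nonneg_left (add_le_add_left h4 Real.pi) (norm_nonneg s)
  simp
  linarith

/-- The function `z^{s+1} M(z)` is a primitive of `z^s e^{-z}`. On the real axis it is the partial
Gamma integral; the mean value inequality on a vertical segment transfers the limit to a parallel
line. -/
theorem tendsto_cpow_mul_line {s : ℂ} (hs : 0 ≤ s.re) {M M' : ℂ → ℂ}
    (hM : ∀ z, HasDerivAt M (M' z) z ∧ z * M' z + (s + 1) * M z = Complex.exp (-z)) (t : ℝ) :
    Tendsto (fun x : ℝ => (x + t * Complex.I : ℂ) ^ (s + 1) * M (x + t * Complex.I)) atTop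
      (𝓝 (Complex.Gamma (s + 1))) := by
  have hs1 : 0 < (s + 1).re := by rw [Complex.add_re, Complex.one_re]; linarith
  have hF : ∀ z : ℂ, 0 < z.re → HasDerivAt (fun z : ℂ => z ^ (s + 1) * M z)
      (z ^ s * Complex.exp (-z)) z := by
    intro z hz
    have hz0 : z ≠ 0 := fun h => by rw [h] at hz; simp at hz
    have h1 := ((hasDerivAt_id z).cpow_const (c := s + 1) (Or.inl hz)).mul (hM z).1
    convert! h1 using 1
    simp only [id, add_sub_cancel_right, mul_one]
    rw [Complex.cpow_add _ _ hz0, Complex.cpow_one, ← (hM z).2]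
    ring
  have hreal : Tendsto (fun x : ℝ => (x : ℂ) ^ (s + 1) * M x) atTop
      (𝓝 (Complex.Gamma (s + 1))) := by
    rw [Complex.Gamma_eq_integral hs1]
    refine (Complex.tendsto_partialGamma hs1).congr' ?_
    filter_upwards [eventually_ge_atTop 0] with x hx
    have hcM : Continuous M := continuous_iff_continuousAt.2 fun z => (hM z).1.continuousAt
    rw [Complex.partialGamma, intervalIntegral.integral_eq_sub_of_hasDerivAt_of_le hx
      (f := fun x : ℝ => (x : ℂ) ^ (s + 1) * M x)]
    · simp [Complex.zero_cpow (fun h => by rw [h] at hs1; simp at hs1 : s + 1 ≠ 0)]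
    · exact ((Complex.continuous_ofReal_cpow_const hs1).mul
        (hcM.comp Complex.continuous_ofReal)).continuousOn
    · intro y hy
      have := (hF y (by simpa using hy.1)).comp_ofReal
      convert! this using 1
      push_cast
      rw [add_sub_cancel_right, mul_comm]
    · rw [intervalIntegrable_iff_integrableOn_Ioc_of_le hx]
      exact (Complex.GammaIntegral_convergent hs1).mono_set Set.Ioc_subset_Ioi_self
  have hdiff : Tendsto (fun x : ℝ => (x + t * Complex.I : ℂ) ^ (s + 1) * M (x + t * Complex.I)
      - (x : ℂ) ^ (s + 1) * M x) atTop (𝓝 0) := by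
    have h0 : Tendsto (fun x : ℝ => Real.exp (-(1 / 2) * x) * |t|) atTop (𝓝 0) := by
      rw [← zero_mul |t|]
      exact (Real.tendsto_exp_atBot.comp
        (tendsto_id.const_mul_atTop_of_neg (by norm_num))).mul_const _
    refine squeeze_zero_norm' ?_ h0
    filter_upwards [eventually_norm_cpow_mul_exp_le s t, eventually_gt_atTop 0] with x hx hx0
    have hder : ∀ u ∈ Set.Icc (-|t|) |t|, HasDerivWithinAt
        (fun u : ℝ => (x + u * Complex.I : ℂ) ^ (s + 1) * M (x + u * Complex.I))
        ((x + u * Complex.I : ℂ) ^ s * Complex.exp (-(x + u * Complex.I)) * Complex.I)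
        (Set.Icc (-|t|) |t|) u := by
      intro u _
      have h1 := hF (x + u * Complex.I) (by simpa using hx0)
      have h2 : HasDerivAt (fun y : ℂ => (x : ℂ) + y * Complex.I) (1 * Complex.I) (u : ℂ) :=
        ((hasDerivAt_id _).mul_const _).const_add _
      have h3 := (HasDerivAt.comp (u : ℂ) h1 h2).comp_ofReal
      rw [one_mul] at h3
      exact h3.hasDerivWithinAt
    have := Convex.norm_image_sub_le_of_norm_hasDerivWithin_le (C := Real.exp (-(1 / 2) * x))
      hder (fun u hu => by rw [norm_mul, Complex.norm_I, mul_one]; exact hx u (abs_le.2 hu))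
      (convex_Icc _ _) (x := 0) (y := t) ⟨by simp, by simp⟩ (abs_le.1 le_rfl)
    simpa using this
  simpa using hdiff.add hreal

theorem branchPow_of_im_pos {z : ℂ} (hz : 0 < z.im) (a : ℂ) : branchPow z a = z ^ a := by
  have hz0 : z ≠ 0 := fun h => by rw [h] at hz; simp at hz
  have : branchLog z = Complex.log z := by
    rw [branchLog, Complex.log, Complex.log, norm_neg, Complex.arg_neg_eq_arg_sub_pi_of_im_pos hz]
    push_cast
    ring
  rw [branchPow, this, Complex.cpow_def_of_ne_zero hz0, mul_comm]

/-- The branch is principal above the cut and exceeds the principal one by `2πi` below it; this jump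
produces the factor `e^{2πiα} - 1`. -/
theorem branchPow_of_im_neg {z : ℂ} (hz : z.im < 0) (a : ℂ) :
    branchPow z a = Complex.exp (2 * Real.pi * a * Complex.I) * z ^ a := by
  have hz0 : z ≠ 0 := fun h => by rw [h] at hz; simp at hz
  have : branchLog z = Complex.log z + 2 * Real.pi * Complex.I := by
    rw [branchLog, Complex.log, Complex.log, norm_neg, Complex.arg_neg_eq_arg_add_pi_of_im_neg hz]
    push_cast
    ring
  rw [branchPow, this, Complex.cpow_def_of_ne_zero hz0, ← Complex.exp_add]
  ring_nf

theorem exp_two_pi_mul_add_one (s : ℂ) : Complex.exp (2 * Real.pi * (s + 1) * Complex.I)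
    = Complex.exp (2 * Real.pi * s * Complex.I) := by
  rw [show 2 * Real.pi * (s + 1) * Complex.I
    = 2 * Real.pi * s * Complex.I + 2 * Real.pi * Complex.I by ring, Complex.exp_add,
    Complex.exp_two_pi_mul_I, mul_one]

variable {r : ℝ}

theorem pathIntegrable_branchPow (hr : 0 < r) (s : ℂ) :
    PathIntegrable r (fun z => branchPow z s * Complex.exp (-z)) :=
  (moderate_branchPow hr s).pathIntegrable hr

theorem pathIntegral_branchPow_of_re_nonneg (hr : 0 < r) {s : ℂ} (hs : 0 ≤ s.re) :
    pathIntegral r (fun z => branchPow z s * Complex.exp (-z))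
      = (Complex.exp (2 * Real.pi * s * Complex.I) - 1) * Complex.Gamma (s + 1) := by
  obtain ⟨M, M', hM⟩ := exists_entire_incomplete_gamma_factor hs
  have hG : ∀ z ∈ pathSet r, HasDerivAt (fun z => branchPow z (s + 1) * M z)
      (branchPow z s * Complex.exp (-z)) z := by
    intro z hz
    have h1 := (hasDerivAt_branchPow (neg_mem_slitPlane hr hz) (s + 1)).mul (hM z).1
    convert! h1 using 1
    rw [add_sub_cancel_right, branchPow_add_one (ne_zero_of_mem_pathSet hr hz), ← (hM z).2]
    ring
  rw [pathIntegral_of_hasDerivAt hr hG (pathIntegrable_branchPow hr s)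
    (l₁ := Complex.Gamma (s + 1))
    (l₂ := Complex.exp (2 * Real.pi * s * Complex.I) * Complex.Gamma (s + 1))]
  · ring
  · refine (tendsto_cpow_mul_line hs hM r).congr fun x => ?_
    rw [branchPow_of_im_pos (by simpa using hr)]
  · refine ((tendsto_cpow_mul_line hs hM (-r)).const_mul _).congr fun x => ?_
    rw [branchPow_of_im_neg (by simpa using hr), exp_two_pi_mul_add_one]
    push_cast
    rw [neg_mul, ← sub_eq_add_neg]
    ring

theorem pathIntegral_branchPow_add_one (hr : 0 < r) (s : ℂ) :
    pathIntegral r (fun z => branchPow z (s + 1) * Complex.exp (-z))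
      = (s + 1) * pathIntegral r (fun z => branchPow z s * Complex.exp (-z)) := by
  have h1 := pathIntegrable_branchPow hr (s + 1)
  have h2 := pathIntegrable_branchPow hr s
  -- The constant polynomial `-1` supplies the sign in the primitive `-z^{s+1} e^{-z}`.
  have h := (moderate_branchPow hr (s + 1)).mul (moderate_eval (r := r) (-1))
  have := pathIntegral_eq_zero hr h (h1.sub_const_mul h2 (s + 1)) (fun z hz => ?_)
  · rw [pathIntegral_sub_const_mul h1 h2] at this
    exact sub_eq_zero.1 this
  · have d := ((hasDerivAt_branchPow (neg_mem_slitPlane hr hz) (s + 1)).mul_const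
      (eval z (-1 : ℂ[X]))).mul (hasDerivAt_neg z).cexp
    convert! d using 1
    · ext w
      simp
    · simp
      ring

/-- Both sides satisfy `I(s + 1) = (s + 1) I(s)`, so the case `Re s ≥ 0` descends to the left; `hs`
keeps every divisor `s + 1` nonzero. -/
theorem pathIntegral_branchPow (hr : 0 < r) (s : ℂ) (hs : ∀ j : ℕ, s ≠ -((j : ℂ) + 1)) :
    pathIntegral r (fun z => branchPow z s * Complex.exp (-z))
      = (Complex.exp (2 * Real.pi * s * Complex.I) - 1) * Complex.Gamma (s + 1) := by
  obtain ⟨N, hN⟩ := exists_nat_ge (-s.re)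
  induction N generalizing s with
  | zero => exact pathIntegral_branchPow_of_re_nonneg hr (by simpa using hN)
  | succ N ih =>
    have h0 : s + 1 ≠ 0 := fun h => hs 0 (by linear_combination h)
    have h1 := ih (s + 1) (fun j h => hs (j + 1) (by push_cast; linear_combination h)) (by
      simp only [Complex.add_re, Complex.one_re]
      push_cast at hN
      linarith)
    rw [pathIntegral_branchPow_add_one hr, exp_two_pi_mul_add_one,
      Complex.Gamma_add_one _ h0] at h1
    apply mul_left_cancel₀ h0
    linear_combination h1

/-- The Darboux step with constant seed, where `A` is plain differentiation. As derivatives of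
Laguerre polynomials are Laguerre polynomials for `α + 1`, it lowers both indices. -/
theorem pathIntegral_laguerre_derivative (hr : 0 < r) (α : ℂ) (n : ℕ) (Q : ℂ[X]) :
    pathIntegral r (fun z => (derivative (laguerre α n)).eval z * (derivative Q).eval z
      * (branchPow z (α + 1) * Complex.exp (-z) / (1 : ℂ[X]).eval z ^ 2))
    = n * pathIntegral r (fun z => (laguerre α n).eval z * Q.eval z
      * (branchPow z α * Complex.exp (-z) / (1 : ℂ[X]).eval z ^ 2)) := by
  have h1 : ∀ z ∈ pathSet r, (1 : ℂ[X]).eval z ≠ 0 := fun z _ => by simp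
  have := pathIntegral_darboux_step hr (α + 1) 0 (-n) (P := laguerre α n)
    (P₁ := derivative (laguerre α n)) (Q := Q) (Q₁ := derivative Q) h1 h1 (by simp) (by
      have := laguerre_ode α n
      simp only [derivative_one, C_0, C_neg]
      linear_combination this)
  rw [this, add_sub_cancel_right, neg_neg]

/-- Orthogonality of the Laguerre polynomials on `Λ_r`. -/
theorem pathIntegral_laguerre (hr : 0 < r) (α : ℂ) (hα : ∀ j : ℕ, α ≠ -((j : ℂ) + 1)) (n m : ℕ) :
    pathIntegral r (fun z => (laguerre α n).eval z * (laguerre α m).eval z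
      * (branchPow z α * Complex.exp (-z) / (1 : ℂ[X]).eval z ^ 2))
    = (Complex.exp (2 * Real.pi * α * Complex.I) - 1)
      * (Complex.Gamma ((n : ℂ) + α + 1) / n.factorial) * if n = m then 1 else 0 := by
  have hzero : pathIntegral r (fun _ => 0) = 0 := by simp [pathIntegral]
  have hmixed : ∀ (α : ℂ) (m : ℕ), pathIntegral r (fun z => (laguerre α (m + 1)).eval z
      * (laguerre α 0).eval z * (branchPow z α * Complex.exp (-z) / (1 : ℂ[X]).eval z ^ 2))
      = 0 := by
    intro α m
    have := pathIntegral_laguerre_derivative hr α (m + 1) (laguerre α 0)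
    rw [laguerre_zero] at this ⊢
    simp only [derivative_one, eval_zero, mul_zero, zero_mul, hzero] at this
    exact (mul_eq_zero.1 this.symm).resolve_left (Nat.cast_ne_zero.2 m.succ_ne_zero)
  induction n generalizing α m with
  | zero =>
    cases m with
    | zero =>
      simpa [laguerre_zero] using pathIntegral_branchPow hr α hα
    | succ m =>
      rw [if_neg (by omega), mul_zero, ← hmixed α m]
      simp only [mul_comm]
  | succ n ih =>
    cases m with
    | zero => rw [if_neg (by omega), mul_zero, hmixed α n]
    | succ m =>
      have h1 := ih (α + 1) (fun j h => hα (j + 1) (by push_cast; linear_combination h)) m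
      have h2 := pathIntegral_laguerre_derivative hr α (n + 1) (laguerre α (m + 1))
      simp only [derivative_laguerre_succ, eval_neg, neg_mul_neg] at h2
      rw [h1, exp_two_pi_mul_add_one] at h2
      have h3 : ((n + 1 : ℕ) : ℂ) ≠ 0 := Nat.cast_ne_zero.2 n.succ_ne_zero
      have h4 : (n.factorial : ℂ) ≠ 0 := Nat.cast_ne_zero.2 n.factorial_ne_zero
      apply mul_left_cancel₀ h3
      rw [← h2, Nat.factorial_succ]
      simp only [Nat.add_right_cancel_iff]
      push_cast at h3 ⊢
      rw [show (n : ℂ) + (α + 1) + 1 = n + 1 + α + 1 by ring]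
      field_simp

end Gamma

end Integration

/-! ### Choice of the radius, the seeds, and the conclusion -/

theorem exists_radius {p : ℂ[X]} (hp : p ≠ 0) :
    ∃ r : ℝ, 0 < r ∧ ∀ z ∈ pathSet r, p.eval z ≠ 0 := by
  classical
  -- Each root lies on `Λ_r` for only one value of `r`, given by the `if`; the two formulas agree on
  -- the imaginary axis.
  obtain ⟨r, hr, hr'⟩ := (Set.Ioi_infinite (0 : ℝ)).exists_notMem_finset
    (p.roots.toFinset.image fun z : ℂ => if 0 ≤ z.re then |z.im| else ‖z‖)
  refine ⟨r, hr, fun z hz h0 => hr' (Finset.mem_image.2 ⟨z, ?_, ?_⟩)⟩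
  · rw [Multiset.mem_toFinset, mem_roots hp]
    exact h0
  · rcases hz with ⟨h1, h2⟩ | ⟨h1, h2⟩
    · rw [if_pos h1, h2]
    · split_ifs with h
      · rw [← h2]
        exact Complex.abs_im_eq_norm.2 (le_antisymm h1 h)
      · exact h2

/-- The twists and values `(c, g)` of the seed functions `exp (c x) g(x)` attached to `F₁`, `F₂`. -/
def seed (α : ℂ) (F₁ F₂ : Finset ℕ) : Fin (F₁.card + F₂.card) → ℂ × ℂ[X] :=
  Fin.append (fun i => (0, laguerre α (F₁.orderEmbOfFin rfl i)))
    (fun i => (1, (laguerre α (F₂.orderEmbOfFin rfl i)).comp (-X)))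

/-- The eigenvalues of the seed functions. -/
def seedEigenvalue (α : ℂ) (F₁ F₂ : Finset ℕ) : Fin (F₁.card + F₂.card) → ℂ :=
  Fin.append (fun i => -((F₁.orderEmbOfFin rfl i : ℕ) : ℂ))
    (fun i => α + 1 + ((F₂.orderEmbOfFin rfl i : ℕ) : ℂ))

/-- Extension of a family indexed by `Fin k` to all natural numbers by a default value. -/
def extend {A : Type*} (a : A) {k : ℕ} (f : Fin k → A) (i : ℕ) : A :=
  if h : i < k then f ⟨i, h⟩ else a

theorem extend_fin {A : Type*} (a : A) {k : ℕ} (f : Fin k → A) (i : Fin k) :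
    extend a f i = f i := by simp [extend]

theorem seed_ne_zero (α : ℂ) (F₁ F₂ : Finset ℕ) (i : Fin (F₁.card + F₂.card)) :
    (seed α F₁ F₂ i).2 ≠ 0 := by
  refine Fin.addCases (fun i => ?_) (fun i => ?_) i
  · simpa [seed] using laguerre_ne_zero _ _
  · simp only [seed, Fin.append_right]
    intro h
    have := congrArg (fun p => p.comp (-X)) h
    simp only [comp_assoc, neg_comp, X_comp, neg_neg, comp_X, zero_comp] at this
    exact laguerre_ne_zero _ _ this

theorem isEigen_seed (α : ℂ) (F₁ F₂ : Finset ℕ) (i : Fin (F₁.card + F₂.card)) :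
    IsEigen (α + 1) (seed α F₁ F₂ i).1 (seed α F₁ F₂ i).2 (seedEigenvalue α F₁ F₂ i) := by
  refine Fin.addCases (fun i => ?_) (fun i => ?_) i
  · simpa [seed, seedEigenvalue] using isEigen_laguerre α _
  · simpa [seed, seedEigenvalue] using isEigen_laguerre_comp_neg α _

theorem seedEigenvalue_injective (α : ℂ) (hα : ∀ j : ℕ, α ≠ -((j : ℂ) + 1)) (F₁ F₂ : Finset ℕ) :
    Function.Injective (seedEigenvalue α F₁ F₂) := by
  -- Equality would force `α = -(f + g + 1)`, a negative integer.
  have key : ∀ f g : ℕ, -(f : ℂ) ≠ α + 1 + g := fun f g h =>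
    hα (f + g) (by push_cast; linear_combination -h)
  intro i j
  refine Fin.addCases (fun i => ?_) (fun i => ?_) i <;>
    refine Fin.addCases (fun j => ?_) (fun j => ?_) j <;>
    simp only [seedEigenvalue, Fin.append_left, Fin.append_right] <;> intro h
  · simpa using h
  · exact absurd h (key _ _)
  · exact absurd h.symm (key _ _)
  · simpa using h

theorem rows_eq (α : ℂ) (F₁ F₂ : Finset ℕ) (i : Fin (F₁.card + F₂.card)) (l : ℕ) :
    rows α F₁ F₂ i l = (polyTwist (seed α F₁ F₂ i).1)^[l] (seed α F₁ F₂ i).2 := by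
  refine Fin.addCases (fun i => ?_) (fun i => ?_) i
  · simp [rows, seed, polyTwist_zero_iterate]
  · simp [rows, seed, laguerre_add_natCast_comp_neg]

theorem Omega_eq_wr (α : ℂ) (F₁ F₂ : Finset ℕ) :
    Omega α F₁ F₂ = wr (extend 0 (seed α F₁ F₂)) (F₁.card + F₂.card) := by
  simp only [Omega, wr, rows_eq, extend_fin]

theorem exceptionalLaguerre_eq_wrSnoc (α : ℂ) (F₁ F₂ : Finset ℕ) (n : ℕ) :
    exceptionalLaguerre α F₁ F₂ (n + shift F₁ F₂) = (-1) ^ (F₁.card + F₂.card)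
      * wrSnoc (extend 0 (seed α F₁ F₂)) (F₁.card + F₂.card) 0 (laguerre α n) := by
  rw [exceptionalLaguerre, det_cons_eq_snoc, Nat.add_sub_cancel]
  have : rows α F₁ F₂ = fun i l => (polyTwist (seed α F₁ F₂ i).1)^[l] (seed α F₁ F₂ i).2 := by
    ext1 i
    ext1 l
    exact rows_eq α F₁ F₂ i l
  simp only [wrSnoc, extend_fin, this, polyTwist_zero_iterate]

theorem prod_seedEigenvalue (α : ℂ) (F₁ F₂ : Finset ℕ) (n : ℕ) :
    ∏ i, (seedEigenvalue α F₁ F₂ i + n)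
      = (∏ f ∈ F₁, ((n : ℂ) - f)) * ∏ f ∈ F₂, ((n : ℂ) + α + f + 1) := by
  have key : ∀ (F : Finset ℕ) (g : ℕ → ℂ),
      ∏ i, g (F.orderEmbOfFin rfl i) = ∏ f ∈ F, g f := by
    intro F g
    conv_rhs => rw [← F.image_orderEmbOfFin_univ rfl]
    rw [Finset.prod_image fun _ _ _ _ h => (F.orderEmbOfFin rfl).injective h]
  rw [Fin.prod_univ_add, ← key F₁, ← key F₂]
  simp only [seedEigenvalue, Fin.append_left, Fin.append_right]
  congr 1 <;> refine Finset.prod_congr rfl fun i _ => ?_ <;> ring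

theorem pathIntegral_wrSnoc {r : ℝ} (hr : 0 < r) (α : ℂ) (φ : ℕ → ℂ × ℂ[X]) (lam : ℕ → ℂ) (N : ℕ)
    (h0 : ∀ i < N, (φ i).2 ≠ 0) (hlam : ∀ i < N, ∀ j < i, lam i ≠ lam j)
    (hE : ∀ i < N, IsEigen (α + 1) (φ i).1 (φ i).2 (lam i))
    (hz : ∀ k ≤ N, ∀ z ∈ pathSet r, (wr φ k).eval z ≠ 0) (n m k : ℕ) (hk : k ≤ N) :
    pathIntegral r (fun z => (wrSnoc φ k 0 (laguerre α n)).eval z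
      * (wrSnoc φ k 0 (laguerre α m)).eval z
      * (branchPow z (α + k) * Complex.exp (-z) / (wr φ k).eval z ^ 2))
    = (∏ i ∈ Finset.range k, (lam i + n))
      * pathIntegral r (fun z => (laguerre α n).eval z * (laguerre α m).eval z
      * (branchPow z α * Complex.exp (-z) / (1 : ℂ[X]).eval z ^ 2)) := by
  obtain ⟨-, h1, h2⟩ := wr_chain (α + 1) φ lam N h0 hlam hE
  induction k with
  | zero => simp [wr, wrSnoc, Fin.snoc]
  | succ k ih =>
    have := pathIntegral_darboux_step hr (α + 1 + k) (φ k).1 (-n - lam k) (hz k (by omega))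
      (hz (k + 1) hk) (h1 k hk (laguerre α m)) (h2 k hk _ _ (isEigen_laguerre α n))
    rw [show α + 1 + (k : ℂ) - 1 = α + k by ring, ih (by omega)] at this
    rw [Finset.prod_range_succ, show α + ((k + 1 : ℕ) : ℂ) = α + 1 + k by push_cast; ring, this]
    ring

/-- The orthogonality relation for exceptional Laguerre polynomials on a path `Λ_r`. -/
theorem exists_radius_orthogonality (α : ℂ) (hα : ∀ j : ℕ, α ≠ -((j : ℂ) + 1))
    (F₁ F₂ : Finset ℕ) :
    ∃ r : ℝ, 0 < r ∧
      (∀ z ∈ pathSet r,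
        (Omega α F₁ F₂).eval z ≠ 0) ∧
      ∀ n m : ℕ,
        PathIntegrable r
          (integrand α F₁ F₂ n m) ∧
        pathIntegral r
          (integrand α F₁ F₂ n m) =
          (Complex.exp (2 * Real.pi * α * Complex.I) - 1)
            * (Complex.Gamma ((n : ℂ) + α + 1)
                * (∏ f ∈ F₁, ((n : ℂ) - (f : ℂ)))
                * (∏ f ∈ F₂, ((n : ℂ) + α + (f : ℂ) + 1))
              / (n.factorial : ℂ))
            * (if n = m then 1 else 0) := by
  have h0 : ∀ i < F₁.card + F₂.card, (extend 0 (seed α F₁ F₂) i).2 ≠ 0 := fun i hi => by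
    rw [extend, dif_pos hi]; exact seed_ne_zero _ _ _ _
  have hlam : ∀ i < F₁.card + F₂.card, ∀ j < i,
      extend 0 (seedEigenvalue α F₁ F₂) i ≠ extend 0 (seedEigenvalue α F₁ F₂) j := by
    intro i hi j hj h
    rw [extend, extend, dif_pos hi, dif_pos (hj.trans hi)] at h
    have := seedEigenvalue_injective α hα F₁ F₂ h
    simp only [Fin.mk.injEq] at this
    omega
  have hE : ∀ i < F₁.card + F₂.card, IsEigen (α + 1) (extend 0 (seed α F₁ F₂) i).1
      (extend 0 (seed α F₁ F₂) i).2 (extend 0 (seedEigenvalue α F₁ F₂) i) := fun i hi => by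
    rw [extend, extend, dif_pos hi, dif_pos hi]; exact isEigen_seed _ _ _ _
  -- The product over all stages is needed: each integration by parts divides by two consecutive
  -- Wronskians, not only by the final `Omega`.
  obtain ⟨r, hr, hr'⟩ := exists_radius
    (p := ∏ k ∈ Finset.range (F₁.card + F₂.card + 1), wr (extend 0 (seed α F₁ F₂)) k)
    (Finset.prod_ne_zero_iff.2 fun k hk =>
      (wr_chain (α + 1) _ _ _ h0 hlam hE).1 k (Nat.lt_succ_iff.1 (Finset.mem_range.1 hk)))
  have hz : ∀ k ≤ F₁.card + F₂.card, ∀ z ∈ pathSet r,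
      (wr (extend 0 (seed α F₁ F₂)) k).eval z ≠ 0 := by
    intro k hk z hz
    have := hr' z hz
    rw [eval_prod] at this
    exact Finset.prod_ne_zero_iff.1 this k (Finset.mem_range.2 (Nat.lt_succ_iff.2 hk))
  refine ⟨r, hr, fun z h => by rw [Omega_eq_wr]; exact hz _ le_rfl z h, fun n m => ?_⟩
  have hint : integrand α F₁ F₂ n m = fun z =>
      (wrSnoc (extend 0 (seed α F₁ F₂)) (F₁.card + F₂.card) 0 (laguerre α n)).eval z
      * (wrSnoc (extend 0 (seed α F₁ F₂)) (F₁.card + F₂.card) 0 (laguerre α m)).eval z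
      * (branchPow z (α + (F₁.card + F₂.card : ℕ)) * Complex.exp (-z)
        / (wr (extend 0 (seed α F₁ F₂)) (F₁.card + F₂.card)).eval z ^ 2) := by
    ext z
    -- Moving the first row to the bottom costs the same sign in both polynomials, so it cancels in
    -- the product.
    have hsign : ((-1 : ℂ) ^ (F₁.card + F₂.card)) * (-1) ^ (F₁.card + F₂.card) = 1 := by
      rw [← mul_pow]; simp
    rw [integrand, exceptionalLaguerre_eq_wrSnoc, exceptionalLaguerre_eq_wrSnoc, Omega_eq_wr]
    simp only [eval_mul, eval_pow, eval_neg, eval_one]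
    rw [mul_mul_mul_comm, hsign, one_mul]
  rw [hint]
  refine ⟨pathIntegrable_rational hr _ _ _ (hz _ le_rfl), ?_⟩
  rw [pathIntegral_wrSnoc hr α _ _ _ h0 hlam hE hz n m _ le_rfl, pathIntegral_laguerre hr α hα,
    Finset.prod_range]
  simp only [extend_fin]
  rw [prod_seedEigenvalue]
  ring

end ExceptionalLaguerre

end

theorem lemma1 (α : ℂ) (hα : ∀ j : ℕ, α ≠ -((j : ℂ) + 1))
    (F₁ F₂ : Finset ℕ) (hF₁ : ∀ f ∈ F₁, 0 < f) (hF₂ : ∀ f ∈ F₂, 0 < f) :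
    ∃ r : ℝ, 0 < r ∧
      (∀ z ∈ ExceptionalLaguerre.pathSet r,
        (ExceptionalLaguerre.Omega α F₁ F₂).eval z ≠ 0) ∧
      ∀ n m : ℕ, n ∉ F₁ → m ∉ F₁ →
        ExceptionalLaguerre.PathIntegrable r
          (ExceptionalLaguerre.integrand α F₁ F₂ n m) ∧
        ExceptionalLaguerre.pathIntegral r
          (ExceptionalLaguerre.integrand α F₁ F₂ n m) =
          (Complex.exp (2 * Real.pi * α * Complex.I) - 1)
            * (Complex.Gamma ((n : ℂ) + α + 1)
                * (∏ f ∈ F₁, ((n : ℂ) - (f : ℂ)))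
                * (∏ f ∈ F₂, ((n : ℂ) + α + (f : ℂ) + 1))
              / (n.factorial : ℂ))
            * (if n = m then 1 else 0) := by
  obtain ⟨r, hr, h, h'⟩ := ExceptionalLaguerre.exists_radius_orthogonality α hα F₁ F₂
  exact ⟨r, hr, h, fun n m _ _ => h' n m⟩
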